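/- Let $J=\mathbb R$ or $J=[0,\infty)$ be the time axis. Let $\Gamma_{\rm ref}\subset\mathbb R^2$ be a $C^3$-smooth Jordan curve (the image of a regular, periodic $C^3$ map $\mathbb R\to\mathbb R^2$ that is injective on a period), let $O_*\supset\Gamma_{\rm ref}$ be an open connected subset of $\mathbb R^2$, and let $\Phi:O_*\times J\to\mathbb R^2$, $(q,t)\mapsto\Phi(q,t)$, be a $C^3$ map such that for every $t\in J$ the map $\Phi(\cdot,t)$ is one-to-one on $O_*$ and its Jacobian matrix $\Phi'_q(q,t)$ is invertible for all $q\in O_*$. Suppose that $\Phi$, its first, second and third derivatives, and $\Phi'_q(\cdot)^{-1}$ are bounded on $O_*\times[0,\infty)$. Put $\Gamma(t):=\Phi(\Gamma_{\rm ref},t)$. For $(r,t)\in\mathbb R^2\times J$ let $\delta(r,t):=\min_{\rho\in\Gamma(t)}\|r-\rho\|$, and let $d(r,t)$ be the signed distance: $d(r,t)=-\delta(r,t)$ if $r$ lies inside $\Gamma(t)$ (that is, $r\notin\Gamma(t)$ and the connected component of $\mathbb R^2\setminus\Gamma(t)$ containing $r$ is bounded), and $d(r,t)=\delta(r,t)$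 otherwise. Let $\pi(r,t)$ denote the point of $\Gamma(t)$ nearest to $r$, when this point is unique. Let $\varkappa(\rho,t)$ be the signed curvature of $\Gamma(t)$ at $\rho\in\Gamma(t)$ for the counterclockwise orientation (the interior lies to the left), i.e. $\varkappa=(x'y''-y'x'')/(x'^2+y'^2)^{3/2}$ in any regular counterclockwise $C^3$ parametrization $(x,y)$; thus a circle of radius $R$ has $\varkappa=1/R$. Then: 1. The functions $\delta$ and $d$ are continuous on $\mathbb R^2\times J$. 2. Let $M\subset\mathbb R^2\times J$ be a set such that for every $(r,t)\in M$ there is exactly one point of $\Gamma(t)$ nearest to $r$. Then $\pi$ is well defined and continuous on $M$. 3. If, in addition, $M$ is (relatively) open in $\mathbb R^2\times J$ and $1+\varkappa[\pi(r,t),t]\,d(r,t)\neq0$ for all $(r,t)\in M$, then $d$ and $\pi$ are of class $C^2$ on $M$ (jointly in $(r,t)$). -/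

import Mathlib

open Set Filter Topology

noncomputable section

namespace MovingCurve

/-- The plane with its Euclidean inner product and norm. -/
abbrev Plane : Type := EuclideanSpace ℝ (Fin 2)

/-- Counterclockwise rotation through `π / 2`. -/
def rot (v : Plane) : Plane := !₂[-(v 1), v 0]

/-- `γ` is a regular `C³` parametrization, periodic of period `L` and injective on one period,
of the set `Γ`. -/
structure IsJordanParam (γ : ℝ → Plane) (L : ℝ) (Γ : Set Plane) : Prop where
  period_pos : 0 < L
  contDiff : ContDiff ℝ 3 γ
  deriv_ne_zero : ∀ s, deriv γ s ≠ 0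
  periodic : Function.Periodic γ L
  injOn : InjOn γ (Ico 0 L)
  range_eq : range γ = Γ

/-- `Γ` is a `C³`-smooth Jordan curve. -/
def IsC3JordanCurve (Γ : Set Plane) : Prop :=
  ∃ (γ : ℝ → Plane) (L : ℝ), IsJordanParam γ L Γ

/-- The region bounded by `Γ`: the union of the bounded connected components of the complement
of `Γ`. -/
def inside (Γ : Set Plane) : Set Plane :=
  {x | x ∈ Γᶜ ∧ Bornology.IsBounded (connectedComponentIn Γᶜ x)}

/-- A parametrization of `Γ` that traverses `Γ` counterclockwise, i.e. with the region bounded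
by `Γ` on its left. -/
structure IsCounterclockwiseParam (γ : ℝ → Plane) (L : ℝ) (Γ : Set Plane) : Prop
    extends IsJordanParam γ L Γ where
  inside_left : ∀ s, ∀ᶠ ε : ℝ in 𝓝[>] 0, γ s + ε • rot (deriv γ s) ∈ inside Γ

/-- `κ` is the signed curvature of `Γ` at `p`, computed in some counterclockwise parametrization:
`κ = (x' y'' - y' x'') / (x'² + y'²) ^ (3/2)`. -/
def IsSignedCurvature (Γ : Set Plane) (p : Plane) (κ : ℝ) : Prop :=
  ∃ (γ : ℝ → Plane) (L s : ℝ), IsCounterclockwiseParam γ L Γ ∧ γ s = p ∧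
    κ = inner ℝ (rot (deriv γ s)) (deriv (deriv γ) s) / ‖deriv γ s‖ ^ 3

/-- The signed curvature of `Γ` at the point `p` of `Γ`. -/
def signedCurvature (Γ : Set Plane) (p : Plane) : ℝ :=
  Classical.epsilon (IsSignedCurvature Γ p)

/-- The unsigned distance from `r` to `Γ`. -/
def unsignedDist (Γ : Set Plane) (r : Plane) : ℝ := Metric.infDist r Γ

open Classical in
/-- The signed distance from `r` to `Γ`: negative inside `Γ`, positive outside. -/
def signedDist (Γ : Set Plane) (r : Plane) : ℝ :=
  if r ∈ inside Γ then -unsignedDist Γ r else unsignedDist Γ r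

/-- `p` is a point of `Γ` nearest to `r`. -/
def IsNearest (Γ : Set Plane) (r p : Plane) : Prop :=
  p ∈ Γ ∧ ∀ q ∈ Γ, dist r p ≤ dist r q

/-- The projection of `r` onto `Γ`: a point of `Γ` nearest to `r` (the point, when there is only
one). -/
def proj (Γ : Set Plane) (r : Plane) : Plane := Classical.epsilon (IsNearest Γ r)

/-- The current configuration at time `t`. -/
def curve (Γref : Set Plane) (Φ : Plane × ℝ → Plane) (t : ℝ) : Set Plane :=
  (fun q => Φ (q, t)) '' Γref

/-- The spatial Jacobian of the configuration map. -/
def jacobian (Φ : Plane × ℝ → Plane) (q : Plane) (t : ℝ) : Plane →L[ℝ] Plane :=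
  fderiv ℝ (fun x => Φ (x, t)) q

/-- The configuration map `Φ`, defined on `O × J`, moves the `C³`-smooth Jordan curve `Γref`. -/
structure IsConfiguration (Γref O : Set Plane) (J : Set ℝ) (Φ : Plane × ℝ → Plane) : Prop where
  jordan : IsC3JordanCurve Γref
  isOpen : IsOpen O
  isConnected : IsConnected O
  subset : Γref ⊆ O
  contDiffOn : ContDiffOn ℝ 3 Φ (O ×ˢ J)
  injOn : ∀ t ∈ J, InjOn (fun q => Φ (q, t)) O
  isInvertible : ∀ t ∈ J, ∀ q ∈ O, (jacobian Φ q t).IsInvertible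

/-- The configuration map, its derivatives of orders one to three with respect to `(q, t)`, and
the inverse of its spatial Jacobian are bounded on `O × [0, ∞)`. -/
def IsBoundedConfiguration (O : Set Plane) (J : Set ℝ) (Φ : Plane × ℝ → Plane) : Prop :=
  ∃ C : ℝ, ∀ q ∈ O, ∀ t : ℝ, 0 ≤ t →
    (∀ k : ℕ, k ≤ 3 → ‖iteratedFDerivWithin ℝ k Φ (O ×ˢ J) (q, t)‖ ≤ C) ∧
    ‖(jacobian Φ q t).inverse‖ ≤ C

end MovingCurve

end

/-! Composing a parametrization of the reference curve with `Φ` gives a `C³` family `g (s, t)` of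
regular Jordan parametrizations of the curves `Γ t`; everything is proved for such families. The
unsigned distance is a minimum of a jointly continuous function over a compact parameter interval,
hence continuous.

For the signed distance one has to control the inside as `r` and `t` vary. Off the curve the winding
integral `∮ dz / (z - r)` is jointly continuous in `(r, t)` and takes values in `2πiℤ`, so it is
locally constant. It is nonzero exactly inside (`exists_isOrientation`, a Jordan curve theorem): it
vanishes on unbounded components, it jumps by `2πi` across the curve, each side of the curve lies in
a single component, and every point off the curve is joined to one of the sides by the segment to a
nearest point. Hence being inside is locally constant off the curve, while at the curve `|d| ≤ δ`
suffices.

A unique minimizer over a compact set depends continuously on the data, so `π = g (s, t)` locally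
with a continuous parameter `s (r, t)`. This `s` solves `F = ⟪g - r, ∂ₛg⟫ = 0`, where `F` is `C²`
and, at the solution, `∂ₛF = |∂ₛg|² (1 + ϰ d)` (`second_variation_eq`). Away from focal points the
implicit function argument makes `s` of class `C²`. Then `π = g (s, t)` is `C²`, and so is `d`,
which equals `⟪r - g, rot ∂ₛg⟫ / |∂ₛg|` up to a locally constant sign. -/

noncomputable section

namespace MovingCurve

/-! ### Winding integrals of closed curves in the complex plane -/

/-- Continuity of an integral with respect to a parameter, on a set. -/
theorem continuousOn_intervalIntegral {X : Type*} [TopologicalSpace X] [FirstCountableTopology X]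
    {f : X → ℝ → ℂ} {S : Set X} {a b : ℝ} (hab : a ≤ b)
    (hf : ContinuousOn (fun z : X × ℝ => f z.1 z.2) (S ×ˢ Icc a b)) :
    ContinuousOn (fun x => ∫ s in a..b, f x s) S := by
  rw [continuousOn_iff_continuous_domRestrict]
  have h1 : Continuous (Function.uncurry fun (x : S) (s : ℝ) => f x (projIcc a b hab s)) := by
    have : Continuous fun z : S × ℝ => ((z.1 : X), (projIcc a b hab z.2 : ℝ)) := by fun_prop
    exact hf.comp_continuous this fun z => ⟨z.1.2, (projIcc a b hab z.2).2⟩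
  have h2 := intervalIntegral.continuous_parametric_intervalIntegral_of_continuous'
    (μ := MeasureTheory.volume) h1 a b
  refine h2.congr fun x => intervalIntegral.integral_congr fun s hs => ?_
  rw [uIcc_of_le hab] at hs
  simp [projIcc_of_mem hab hs]

/-- The winding integral `∮ dz / (z - r)` along `c` on `[a, b]`. -/
def windInt (c : ℝ → ℂ) (a b : ℝ) (r : ℂ) : ℂ := ∫ s in a..b, deriv c s / (c s - r)

theorem windInt_integrable {c : ℝ → ℂ} (hc : ContDiff ℝ 1 c) {a b : ℝ} {r : ℂ}
    (hr : ∀ s ∈ uIcc a b, c s ≠ r) :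
    IntervalIntegrable (fun s => deriv c s / (c s - r)) MeasureTheory.volume a b := by
  apply ContinuousOn.intervalIntegrable
  exact (hc.continuous_deriv le_rfl).continuousOn.div (hc.continuous.sub continuous_const).continuousOn
    fun s hs => sub_ne_zero.2 (hr s hs)

/-- The winding integral of a closed curve is a multiple of `2πi`. -/
theorem windInt_eq_int {c : ℝ → ℂ} (hc : ContDiff ℝ 1 c) {a b : ℝ} {r : ℂ}
    (hr : ∀ s, c s ≠ r) (hcl : c b = c a) :
    ∃ n : ℤ, windInt c a b r = n * (2 * Real.pi * Complex.I) := by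
  have hcont : Continuous fun s => deriv c s / (c s - r) :=
    (hc.continuous_deriv le_rfl).div (hc.continuous.sub continuous_const)
      fun s => sub_ne_zero.2 (hr s)
  have hG : ∀ s, HasDerivAt (fun s => windInt c a s r) (deriv c s / (c s - r)) s := fun s =>
    intervalIntegral.integral_hasDerivAt_right (hcont.intervalIntegrable _ _)
      (hcont.stronglyMeasurableAtFilter _ _) hcont.continuousAt
  -- With `W` the integral up to `s`, `exp (-W) (c - r)` is constant; comparing its values at the
  -- ends of the closed curve gives `exp (-W) = 1`.
  have hd : ∀ s, HasDerivAt (fun s => Complex.exp (-windInt c a s r) * (c s - r)) 0 s := by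
    intro s
    have h1 := ((hG s).fun_neg.cexp).mul
      (((hc.differentiable one_ne_zero s).hasDerivAt).sub_const r)
    refine h1.congr_deriv ?_
    have := div_mul_cancel₀ (deriv c s) (sub_ne_zero.2 (hr s))
    linear_combination -Complex.exp (-windInt c a s r) * this
  have hE := is_const_of_deriv_eq_zero (fun s => (hd s).differentiableAt) (fun s => (hd s).deriv) a b
  have h0 : windInt c a a r = 0 := by simp [windInt]
  simp only [h0, neg_zero, Complex.exp_zero, one_mul, hcl] at hE
  have h1 : Complex.exp (-windInt c a b r) = 1 := by
    have := sub_ne_zero.2 (hr a)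
    exact mul_right_cancel₀ this (by rw [← hE, one_mul])
  rw [Complex.exp_neg, inv_eq_one, Complex.exp_eq_one_iff] at h1
  exact h1

/-- Multiples of `2πi` that are less than `2π` apart agree. -/
theorem eq_of_two_pi_I_int {z w : ℂ} (hz : ∃ n : ℤ, z = n * (2 * Real.pi * Complex.I))
    (hw : ∃ n : ℤ, w = n * (2 * Real.pi * Complex.I)) (h : ‖z - w‖ < 2 * Real.pi) : z = w := by
  obtain ⟨n, rfl⟩ := hz
  obtain ⟨m, rfl⟩ := hw
  have h2 : ‖(2 * Real.pi * Complex.I : ℂ)‖ = 2 * Real.pi := by simp [abs_of_pos Real.pi_pos]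
  rw [← sub_mul, norm_mul, h2, ← Int.cast_sub, Complex.norm_intCast] at h
  have h3 : |((n - m : ℤ) : ℝ)| < 1 := by
    by_contra! h4
    nlinarith [Real.two_pi_pos]
  have h4 : n - m = 0 := Int.abs_lt_one_iff.1 (by exact_mod_cast h3)
  rw [sub_eq_zero.1 h4]

/-- If `c - r` avoids the cut `ζ⁻¹ (-∞, 0]`, its winding integral is a difference of logarithms. -/
theorem windInt_eq_log {c : ℝ → ℂ} (hc : ContDiff ℝ 1 c) {a b : ℝ} {r ζ : ℂ} (hζ : ζ ≠ 0)
    (hr : ∀ s ∈ uIcc a b, ζ * (c s - r) ∈ Complex.slitPlane) :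
    windInt c a b r = Complex.log (ζ * (c b - r)) - Complex.log (ζ * (c a - r)) := by
  have hne : ∀ s ∈ uIcc a b, c s ≠ r := fun s hs h => by
    have := Complex.slitPlane_ne_zero (hr s hs)
    simp [h] at this
  refine intervalIntegral.integral_eq_sub_of_hasDerivAt (f := fun s => Complex.log (ζ * (c s - r)))
    (fun s hs => ?_) (windInt_integrable hc hne)
  have h1 := ((((hc.differentiable one_ne_zero s).hasDerivAt).sub_const r).const_mul ζ).clog_real
    (hr s hs)
  refine h1.congr_deriv ?_
  exact mul_div_mul_left _ _ hζ

theorem windInt_continuousOn {c : ℝ → ℂ} (hc : ContDiff ℝ 1 c) {a b : ℝ} (hab : a ≤ b) :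
    ContinuousOn (windInt c a b) {r | ∀ s ∈ Icc a b, c s ≠ r} := by
  apply continuousOn_intervalIntegral hab
  refine ContinuousOn.div ?_ ?_ ?_
  · exact ((hc.continuous_deriv le_rfl).comp continuous_snd).continuousOn
  · exact ((hc.continuous.comp continuous_snd).sub continuous_fst).continuousOn
  · rintro ⟨r, s⟩ ⟨hr, hs⟩
    exact sub_ne_zero.2 (hr s hs)

/-- An arc that stays away from `0` contributes the same on both sides of the curve. -/
theorem tendsto_windInt_sub_zero {u : ℝ → ℂ} (hu : ContDiff ℝ 1 u) {a b : ℝ} (hab : a ≤ b)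
    (h0 : ∀ s ∈ Icc a b, u s ≠ 0) :
    Tendsto (fun ε : ℝ => windInt u a b (ε * Complex.I) - windInt u a b (-(ε * Complex.I)))
      (𝓝[>] 0) (𝓝 0) := by
  have hopen : IsOpen {r | ∀ s ∈ Icc a b, u s ≠ r} := by
    have : {r | ∀ s ∈ Icc a b, u s ≠ r} = (u '' Icc a b)ᶜ := by
      ext r; simp
    rw [this]
    exact (isCompact_Icc.image hu.continuous).isClosed.isOpen_compl
  have hca : ContinuousAt (windInt u a b) 0 :=
    (windInt_continuousOn hu hab).continuousAt (hopen.mem_nhds h0)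
  have h1 : Tendsto (fun ε : ℝ => (ε * Complex.I : ℂ)) (𝓝[>] 0) (𝓝 0) := by
    have : Continuous fun ε : ℝ => (ε * Complex.I : ℂ) := by fun_prop
    simpa using (this.tendsto 0).mono_left nhdsWithin_le_nhds
  have h2 : Tendsto (fun ε : ℝ => (-(ε * Complex.I) : ℂ)) (𝓝[>] 0) (𝓝 0) := by
    simpa using h1.neg
  simpa using (hca.tendsto.comp h1).sub (hca.tendsto.comp h2)

/-- The logarithms are taken at opposite points, whose arguments differ by `π`. This and the mirror
case `log_I_mul_sub_of_re_neg` are the two halves of the jump `2πi`. -/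
theorem log_I_mul_sub_of_re_pos {z : ℂ} (hz : 0 < z.re) :
    Complex.log (Complex.I * z) - Complex.log (-Complex.I * z) = Real.pi * Complex.I := by
  have him : 0 < (Complex.I * z).im := by simpa using hz
  have h := Complex.arg_neg_eq_arg_sub_pi_of_im_pos him
  rw [neg_mul]
  apply Complex.ext <;> simp [Complex.log_re, Complex.log_im, h]

theorem log_I_mul_sub_of_re_neg {z : ℂ} (hz : z.re < 0) :
    Complex.log (Complex.I * z) - Complex.log (-Complex.I * z) = -(Real.pi * Complex.I) := by
  have him : (Complex.I * z).im < 0 := by simpa using hz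
  have h := Complex.arg_neg_eq_arg_add_pi_of_im_neg him
  rw [neg_mul]
  apply Complex.ext <;> simp [Complex.log_re, Complex.log_im, h]

/-- The local contribution to the jump of the winding integral. -/
theorem tendsto_windInt_sub_local {u : ℝ → ℂ} (hu : ContDiff ℝ 1 u) {s₀ a : ℝ} (ha : 0 < a)
    (h0 : u s₀ = 0) (hre : ∀ s ∈ Icc (s₀ - a) (s₀ + a), 0 < (deriv u s).re) :
    Tendsto (fun ε : ℝ => windInt u (s₀ - a) (s₀ + a) (ε * Complex.I) -
        windInt u (s₀ - a) (s₀ + a) (-(ε * Complex.I)))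
      (𝓝[>] 0) (𝓝 (2 * Real.pi * Complex.I)) := by
  have hd : ∀ s, HasDerivAt (fun s => (u s).re) (deriv u s).re s := fun s =>
    Complex.reCLM.hasFDerivAt.comp_hasDerivAt s (hu.differentiable one_ne_zero s).hasDerivAt
  have hmono : StrictMonoOn (fun s => (u s).re) (Icc (s₀ - a) (s₀ + a)) := by
    apply strictMonoOn_of_deriv_pos (convex_Icc _ _)
    · exact (Complex.continuous_re.comp hu.continuous).continuousOn
    · intro s hs
      rw [(hd s).deriv]
      exact hre s (interior_subset hs)
  have hm : s₀ ∈ Icc (s₀ - a) (s₀ + a) := ⟨by linarith, by linarith⟩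
  have hl : s₀ - a ∈ Icc (s₀ - a) (s₀ + a) := ⟨by linarith, by linarith⟩
  have hr : s₀ + a ∈ Icc (s₀ - a) (s₀ + a) := ⟨by linarith, by linarith⟩
  have hneg : (u (s₀ - a)).re < 0 := by simpa [h0] using hmono hl hm (by linarith)
  have hpos : 0 < (u (s₀ + a)).re := by simpa [h0] using hmono hm hr (by linarith)
  have hz : ∀ s ∈ Icc (s₀ - a) (s₀ + a), (u s).re = 0 → u s = 0 := fun s hs h => by
    have : s = s₀ := hmono.injOn hs hm (by simpa [h0] using h)
    rw [this, h0]
  have hI : (s₀ - a) ≤ s₀ + a := by linarith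
  -- The branch `log (I * z)` is cut along the ray going up from `r = εi`. The arc meets the
  -- imaginary axis only at `0`, below `r`, so it misses the cut. For `r = -εi` the factor `-I`
  -- turns the cut downwards.
  have hp : ∀ ε : ℝ, 0 < ε → windInt u (s₀ - a) (s₀ + a) (ε * Complex.I) =
      Complex.log (Complex.I * (u (s₀ + a) - ε * Complex.I)) -
        Complex.log (Complex.I * (u (s₀ - a) - ε * Complex.I)) := fun ε hε => by
    refine windInt_eq_log hu Complex.I_ne_zero fun s hs => ?_
    rw [uIcc_of_le hI] at hs
    rw [Complex.mem_slitPlane_iff]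
    by_cases h : (u s).re = 0
    · left; simp [hz s hs h, hε]
    · right; simpa using h
  have hn : ∀ ε : ℝ, 0 < ε → windInt u (s₀ - a) (s₀ + a) (-(ε * Complex.I)) =
      Complex.log (-Complex.I * (u (s₀ + a) - -(ε * Complex.I))) -
        Complex.log (-Complex.I * (u (s₀ - a) - -(ε * Complex.I))) := fun ε hε => by
    refine windInt_eq_log hu (neg_ne_zero.2 Complex.I_ne_zero) fun s hs => ?_
    rw [uIcc_of_le hI] at hs
    rw [Complex.mem_slitPlane_iff]
    by_cases h : (u s).re = 0
    · left; simp [hz s hs h, hε]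
    · right; simpa using h
  have key : ∀ (ζ v : ℂ) (σ : ℂ), ζ * v ∈ Complex.slitPlane → Tendsto (fun ε : ℝ =>
      Complex.log (ζ * (v - σ * (ε * Complex.I)))) (𝓝[>] 0) (𝓝 (Complex.log (ζ * v))) := by
    intro ζ v σ h
    have hc : ContinuousAt (fun ε : ℝ => Complex.log (ζ * (v - σ * (ε * Complex.I)))) 0 := by
      refine ContinuousAt.clog (by fun_prop) (by simpa using h)
    simpa using hc.tendsto.mono_left nhdsWithin_le_nhds
  have m1 : ∀ v : ℂ, v.re ≠ 0 → Complex.I * v ∈ Complex.slitPlane := fun v hv => by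
    rw [Complex.mem_slitPlane_iff]; right; simpa using hv
  have m2 : ∀ v : ℂ, v.re ≠ 0 → -Complex.I * v ∈ Complex.slitPlane := fun v hv => by
    rw [Complex.mem_slitPlane_iff]; right; simpa using hv
  have lim := ((key _ _ 1 (m1 _ hpos.ne')).sub (key _ _ 1 (m1 _ hneg.ne))).sub
    ((key _ _ (-1) (m2 _ hpos.ne')).sub (key _ _ (-1) (m2 _ hneg.ne)))
  have e := log_I_mul_sub_of_re_pos hpos
  have e' := log_I_mul_sub_of_re_neg hneg
  have hval : (2 * Real.pi * Complex.I : ℂ) =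
      Complex.log (Complex.I * u (s₀ + a)) - Complex.log (Complex.I * u (s₀ - a)) -
      (Complex.log (-Complex.I * u (s₀ + a)) - Complex.log (-Complex.I * u (s₀ - a))) := by
    linear_combination -e + e'
  rw [hval]
  refine lim.congr' ?_
  filter_upwards [self_mem_nhdsWithin] with ε hε
  rw [hp ε hε, hn ε hε]
  simp only [one_mul, neg_mul]

/-- The winding integral of a closed curve jumps by `2πi` across a simple regular point. -/
theorem windInt_jump {c : ℝ → ℂ} (hc : ContDiff ℝ 1 c) {L : ℝ} (hL : 0 < L)
    (hper : Function.Periodic c L) {s₀ : ℝ} (hne : deriv c s₀ ≠ 0)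
    (hinj : ∀ s ∈ Icc (s₀ - L / 2) (s₀ + L / 2), c s = c s₀ → s = s₀)
    (hoff : ∀ᶠ ε : ℝ in 𝓝[>] 0, ∀ s, c s ≠ c s₀ + ε * (Complex.I * deriv c s₀) ∧
      c s ≠ c s₀ - ε * (Complex.I * deriv c s₀)) :
    ∀ᶠ ε : ℝ in 𝓝[>] 0, windInt c 0 L (c s₀ + ε * (Complex.I * deriv c s₀)) -
      windInt c 0 L (c s₀ - ε * (Complex.I * deriv c s₀)) = 2 * Real.pi * Complex.I := by
  -- Normalized to `u s₀ = 0` and `u' s₀ = 1`, so that the normal at `s₀` becomes the imaginary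
  -- axis.
  set u : ℝ → ℂ := fun s => (c s - c s₀) / deriv c s₀ with hu_def
  have hu : ContDiff ℝ 1 u := (hc.sub contDiff_const).div_const _
  have hdu : ∀ s, deriv u s = deriv c s / deriv c s₀ := fun s => by
    simp [hu_def]
  have hu0 : u s₀ = 0 := by simp [hu_def]
  have hu1 : ∀ s ∈ Icc (s₀ - L / 2) (s₀ + L / 2), u s = 0 → s = s₀ := fun s hs h => by
    apply hinj s hs
    simpa [hu_def, hne, sub_eq_zero] using h
  have hcd : Continuous fun s => (deriv u s).re :=
    Complex.continuous_re.comp (hu.continuous_deriv le_rfl)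
  have hre0 : 0 < (deriv u s₀).re := by rw [hdu, div_self hne]; simp
  obtain ⟨a₁, ha₁, hball⟩ := Metric.eventually_nhds_iff.1 (hcd.continuousAt.eventually_const_lt hre0)
  -- Half of `a₁` keeps the closed interval inside the open ball; `L / 4` keeps it within half a
  -- period on each side.
  set a := min (a₁ / 2) (L / 4)
  have ha : 0 < a := by positivity
  have haL : a ≤ L / 4 := min_le_right _ _
  have haa : a ≤ a₁ / 2 := min_le_left _ _
  have hre : ∀ s ∈ Icc (s₀ - a) (s₀ + a), 0 < (deriv u s).re := fun s hs => by
    apply hball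
    rw [Real.dist_eq, abs_lt]
    constructor <;> linarith [hs.1, hs.2]
  have l1 := tendsto_windInt_sub_zero hu (a := s₀ - L / 2) (b := s₀ - a) (by linarith)
    fun s hs h => by
      have := hu1 s ⟨hs.1, by linarith [hs.2]⟩ h
      linarith [hs.2]
  have l2 := tendsto_windInt_sub_local hu ha hu0 hre
  have l3 := tendsto_windInt_sub_zero hu (a := s₀ + a) (b := s₀ + L / 2) (by linarith)
    fun s hs h => by
      have := hu1 s ⟨by linarith [hs.1], hs.2⟩ h
      linarith [hs.1]
  have lim := (l1.add l2).add l3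
  simp only [zero_add, add_zero] at lim
  have hW : ∀ z : ℂ, windInt c 0 L (c s₀ + z * deriv c s₀) =
      windInt u (s₀ - L / 2) (s₀ + L / 2) z := fun z => by
    have hp : Function.Periodic (fun s => deriv c s / (c s - (c s₀ + z * deriv c s₀))) L := by
      intro s
      have : deriv c (s + L) = deriv c s := by
        rw [← deriv_comp_add_const]
        congr 1
        exact funext hper
      simp only [this, hper s]
    have h1 := hp.intervalIntegral_add_eq 0 (s₀ - L / 2)
    rw [zero_add, show s₀ - L / 2 + L = s₀ + L / 2 by ring] at h1
    rw [windInt, h1, windInt]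
    congr 1
    ext s
    rw [hdu, hu_def]
    rw [show c s - (c s₀ + z * deriv c s₀) = deriv c s₀ * ((c s - c s₀) / deriv c s₀ - z) by
      field_simp; ring]
    rw [div_div]
  have hsplit : ∀ z : ℂ, (∀ s ∈ Icc (s₀ - L / 2) (s₀ + L / 2), u s ≠ z) →
      windInt u (s₀ - L / 2) (s₀ + L / 2) z = windInt u (s₀ - L / 2) (s₀ - a) z +
        windInt u (s₀ - a) (s₀ + a) z + windInt u (s₀ + a) (s₀ + L / 2) z := fun z hz => by
    have hi : ∀ p q, p ∈ Icc (s₀ - L / 2) (s₀ + L / 2) → q ∈ Icc (s₀ - L / 2) (s₀ + L / 2) →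
        IntervalIntegrable (fun s => deriv u s / (u s - z)) MeasureTheory.volume p q :=
      fun p q hp hq => windInt_integrable hu fun s hs => hz s (uIcc_subset_Icc hp hq hs)
    have e1 : s₀ - L / 2 ∈ Icc (s₀ - L / 2) (s₀ + L / 2) := ⟨by linarith, by linarith⟩
    have e2 : s₀ - a ∈ Icc (s₀ - L / 2) (s₀ + L / 2) := ⟨by linarith, by linarith⟩
    have e3 : s₀ + a ∈ Icc (s₀ - L / 2) (s₀ + L / 2) := ⟨by linarith, by linarith⟩
    have e4 : s₀ + L / 2 ∈ Icc (s₀ - L / 2) (s₀ + L / 2) := ⟨by linarith, by linarith⟩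
    simp only [windInt]
    rw [intervalIntegral.integral_add_adjacent_intervals (hi _ _ e1 e2) (hi _ _ e2 e3),
      intervalIntegral.integral_add_adjacent_intervals (hi _ _ e1 e3) (hi _ _ e3 e4)]
  have lim' : Tendsto (fun ε : ℝ => windInt c 0 L (c s₀ + ε * (Complex.I * deriv c s₀)) -
      windInt c 0 L (c s₀ - ε * (Complex.I * deriv c s₀)))
      (𝓝[>] 0) (𝓝 (2 * Real.pi * Complex.I)) := by
    refine lim.congr' ?_
    filter_upwards [hoff] with ε hε
    have hz1 : ∀ s ∈ Icc (s₀ - L / 2) (s₀ + L / 2), u s ≠ ε * Complex.I := fun s _ h =>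
      (hε s).1 (by rw [hu_def, div_eq_iff hne] at h; linear_combination h)
    have hz2 : ∀ s ∈ Icc (s₀ - L / 2) (s₀ + L / 2), u s ≠ -(ε * Complex.I) := fun s _ h =>
      (hε s).2 (by rw [hu_def, div_eq_iff hne] at h; linear_combination h)
    rw [show c s₀ + ε * (Complex.I * deriv c s₀) = c s₀ + ε * Complex.I * deriv c s₀ by ring,
      show c s₀ - ε * (Complex.I * deriv c s₀) = c s₀ + -(ε * Complex.I) * deriv c s₀ by ring,
      hW, hW, hsplit _ hz1, hsplit _ hz2]
    ring
  -- The difference lies in `2πiℤ` and tends to `2πi`, so it eventually equals `2πi`.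
  filter_upwards [hoff, lim' (Metric.ball_mem_nhds _ Real.two_pi_pos)] with ε hε hball
  have hcl : c L = c 0 := by simpa using hper 0
  refine eq_of_two_pi_I_int ?_ ⟨1, by simp⟩ (by simpa [dist_eq_norm] using hball)
  obtain ⟨n, hn⟩ := windInt_eq_int hc (a := 0) (b := L) (fun s => (hε s).1) hcl
  obtain ⟨m, hm⟩ := windInt_eq_int hc (a := 0) (b := L) (fun s => (hε s).2) hcl
  exact ⟨n - m, by rw [hn, hm]; push_cast; ring⟩

/-! ### The plane as the complex line -/

/-- The isometric identification of the plane with `ℂ`. -/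
def toC : Plane ≃ₗᵢ[ℝ] ℂ := Complex.orthonormalBasisOneI.repr.symm

theorem toC_rot (v : Plane) : toC (rot v) = Complex.I * toC v := by
  simp only [toC, Complex.orthonormalBasisOneI_repr_symm_apply, rot]
  apply Complex.ext <;> simp

/-- `rot` as a continuous linear map. -/
def rotL : Plane →L[ℝ] Plane :=
  (toC.symm.toContinuousLinearEquiv : ℂ →L[ℝ] Plane) ∘L
    (ContinuousLinearMap.mul ℝ ℂ Complex.I) ∘L (toC.toContinuousLinearEquiv : Plane →L[ℝ] ℂ)

theorem rotL_apply (v : Plane) : rotL v = rot v := by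
  apply toC.injective
  simp [rotL, toC_rot]

theorem continuous_rot : Continuous rot := by
  have : rot = rotL := funext fun v => (rotL_apply v).symm
  rw [this]; exact rotL.continuous

theorem norm_rot (v : Plane) : ‖rot v‖ = ‖v‖ := by
  rw [← toC.norm_map, toC_rot, norm_mul, Complex.norm_I, one_mul, toC.norm_map]

theorem rot_ne_zero {v : Plane} (hv : v ≠ 0) : rot v ≠ 0 := by
  rw [← norm_ne_zero_iff, norm_rot]; exact norm_ne_zero_iff.2 hv

theorem inner_rot_self (v : Plane) : inner ℝ (rot v) v = (0 : ℝ) := by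
  simp [PiLp.inner_apply, Fin.sum_univ_two, rot]; ring

/-- A vector orthogonal to `v ≠ 0` is a multiple of `rot v`. -/
theorem eq_smul_rot {v w : Plane} (hv : v ≠ 0) (h : inner ℝ w v = (0 : ℝ)) :
    w = (inner ℝ w (rot v) / ‖v‖ ^ 2) • rot v := by
  have hv2 : ‖v‖ ^ 2 ≠ 0 := pow_ne_zero _ (norm_ne_zero_iff.2 hv)
  have key : ‖v‖ ^ 2 • w = (inner ℝ w (rot v) : ℝ) • rot v := by
    rw [EuclideanSpace.norm_sq_eq]
    simp [PiLp.inner_apply, Fin.sum_univ_two, rot] at h ⊢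
    ext i
    fin_cases i
    · simp; linear_combination v 0 * h
    · simp; linear_combination v 1 * h
  rw [div_eq_inv_mul, mul_smul, ← key, smul_smul, inv_mul_cancel₀ hv2, one_smul]

/-! ### Elementary properties of Jordan curves -/

namespace IsJordanParam

variable {γ : ℝ → Plane} {L : ℝ} {Γ : Set Plane}

theorem continuous (h : IsJordanParam γ L Γ) : Continuous γ := h.contDiff.continuous

theorem hasDerivAt (h : IsJordanParam γ L Γ) (s : ℝ) : HasDerivAt γ (deriv γ s) s :=
  (h.contDiff.differentiable (by norm_num) s).hasDerivAt

theorem continuous_deriv (h : IsJordanParam γ L Γ) : Continuous (deriv γ) :=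
  h.contDiff.continuous_deriv (by norm_num)

theorem mem (h : IsJordanParam γ L Γ) (s : ℝ) : γ s ∈ Γ := h.range_eq ▸ mem_range_self s

theorem isCompact (h : IsJordanParam γ L Γ) : IsCompact Γ := by
  rw [← h.range_eq, ← h.periodic.image_Icc h.period_pos 0]
  exact isCompact_Icc.image h.continuous

theorem nonempty (h : IsJordanParam γ L Γ) : Γ.Nonempty := ⟨_, h.mem 0⟩

theorem exists_param (h : IsJordanParam γ L Γ) {p : Plane} (hp : p ∈ Γ) (s₀ : ℝ) :
    ∃ s ∈ Icc (s₀ - L / 2) (s₀ + L / 2), γ s = p := by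
  rw [← h.range_eq] at hp
  obtain ⟨x, rfl⟩ := hp
  obtain ⟨y, hy, hxy⟩ := h.periodic.exists_mem_Ico h.period_pos x (s₀ - L / 2)
  exact ⟨y, ⟨hy.1, by linarith [hy.2]⟩, hxy.symm⟩

/-- Reduction modulo `L` shows that `s - s₀` is an integer multiple of `L`, and it is shorter than
`L`. -/
theorem eq_of_abs_lt (h : IsJordanParam γ L Γ) {s₀ s : ℝ} (hs : |s - s₀| < L)
    (heq : γ s = γ s₀) : s = s₀ := by
  have hL := h.period_pos
  have hmod : toIcoMod hL 0 s = toIcoMod hL 0 s₀ := by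
    apply h.injOn
    · simpa using toIcoMod_mem_Ico hL 0 s
    · simpa using toIcoMod_mem_Ico hL 0 s₀
    · simp only [toIcoMod, h.periodic.sub_zsmul_eq, heq]
  simp only [toIcoMod, zsmul_eq_mul] at hmod
  set m := toIcoDiv hL 0 s
  set n := toIcoDiv hL 0 s₀
  have h1 : s - s₀ = ((m - n : ℤ) : ℝ) * L := by push_cast; linarith
  have h2 : |((m - n : ℤ) : ℝ)| < 1 := by
    rw [h1, abs_mul, abs_of_pos hL] at hs
    by_contra! h4
    nlinarith
  have h5 : m - n = 0 := Int.abs_lt_one_iff.1 (by exact_mod_cast h2)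
  rw [h5, Int.cast_zero, zero_mul] at h1
  linarith

theorem eq_of_mem_Icc (h : IsJordanParam γ L Γ) {s₀ s : ℝ}
    (hs : s ∈ Icc (s₀ - L / 2) (s₀ + L / 2)) (heq : γ s = γ s₀) : s = s₀ := by
  have hL := h.period_pos
  refine h.eq_of_abs_lt ?_ heq
  rw [abs_lt]
  constructor <;> linarith [hs.1, hs.2]

/-- The parameter depends continuously on the point of the curve. -/
theorem exists_dist_lt (h : IsJordanParam γ L Γ) (s₀ : ℝ) {a : ℝ} (ha : 0 < a) :
    ∃ ρ > 0, ∀ s ∈ Icc (s₀ - L / 2) (s₀ + L / 2), dist (γ s) (γ s₀) < ρ → |s - s₀| < a := by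
  set K : Set ℝ := Icc (s₀ - L / 2) (s₀ + L / 2) ∩ {s | a ≤ |s - s₀|}
  have hK : IsCompact K := isCompact_Icc.inter_right
    (isClosed_le continuous_const (by fun_prop))
  have h0 : γ s₀ ∉ γ '' K := by
    rintro ⟨s, ⟨hs, hs'⟩, heq⟩
    have := h.eq_of_mem_Icc hs heq
    simp only [mem_ofPred_eq, this, sub_self, abs_zero] at hs'
    linarith
  obtain ⟨ρ, hρ, hb⟩ := Metric.isOpen_iff.1 (hK.image h.continuous).isClosed.isOpen_compl _ h0
  refine ⟨ρ, hρ, fun s hs hd => ?_⟩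
  by_contra! hlt
  exact hb hd ⟨s, ⟨hs, hlt⟩, rfl⟩

/-- A neighbourhood of a piece of the curve, along the normals, meets the curve only there. -/
theorem exists_collar (h : IsJordanParam γ L Γ) (s₀ : ℝ) :
    ∃ b > 0, ∀ s, |s - s₀| < b → ∀ η : ℝ, η ≠ 0 → |η| < b → γ s + η • rot (deriv γ s) ∉ Γ := by
  have hc : Continuous fun z : ℝ × ℝ => (inner ℝ (deriv γ z.1) (deriv γ z.2) : ℝ) :=
    (h.continuous_deriv.comp continuous_fst).inner (h.continuous_deriv.comp continuous_snd)
  have h0 : 0 < (inner ℝ (deriv γ s₀) (deriv γ s₀) : ℝ) :=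
    real_inner_self_pos.2 (h.deriv_ne_zero s₀)
  obtain ⟨a, ha, hpos⟩ := Metric.eventually_nhds_iff.1
    ((hc.continuousAt (x := (s₀, s₀))).eventually_const_lt h0)
  obtain ⟨ρ, hρ, hnear⟩ := h.exists_dist_lt s₀ ha
  have hc2 : Continuous fun z : ℝ × ℝ => γ z.1 + z.2 • rot (deriv γ z.1) :=
    (h.continuous.comp continuous_fst).add
      (continuous_snd.smul (continuous_rot.comp (h.continuous_deriv.comp continuous_fst)))
  obtain ⟨b, hb, hclose⟩ := Metric.continuousAt_iff.1 (hc2.continuousAt (x := (s₀, 0))) ρ hρ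
  refine ⟨min a b, lt_min ha hb, fun s hs η hη hηb hmem => ?_⟩
  obtain ⟨σ, hσ, heq⟩ := h.exists_param hmem s₀
  have hσa : |σ - s₀| < a := by
    apply hnear σ hσ
    rw [heq]
    have := @hclose (s, η) (by
      simp only [Prod.dist_eq, Real.dist_eq, sub_zero, sup_lt_iff]
      exact ⟨hs.trans_le (min_le_right _ _), hηb.trans_le (min_le_right _ _)⟩)
    simpa using this
  have hsa : |s - s₀| < a := hs.trans_le (min_le_left _ _)
  -- Moving along the normal at `s` does not change the component along `γ' s`, and that component
  -- is strictly monotone in the parameter near `s₀`. So a curve point on this normal can only be `γ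
  -- s` itself.
  have hmono : StrictMonoOn (fun ξ => (inner ℝ (γ ξ) (deriv γ s) : ℝ)) (Metric.ball s₀ a) := by
    apply strictMonoOn_of_deriv_pos (convex_ball _ _)
    · exact (h.continuous.inner continuous_const).continuousOn
    · intro ξ hξ
      have hd : HasDerivAt (fun ξ => (inner ℝ (γ ξ) (deriv γ s) : ℝ))
          (inner ℝ (γ ξ) (0 : Plane) + inner ℝ (deriv γ ξ) (deriv γ s)) ξ :=
        (h.hasDerivAt ξ).inner ℝ (hasDerivAt_const ξ _)
      rw [hd.deriv, inner_zero_right, zero_add]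
      apply @hpos (ξ, s)
      simp only [Prod.dist_eq, Real.dist_eq, sup_lt_iff]
      exact ⟨by simpa [Real.dist_eq] using interior_subset hξ, hsa⟩
  have hse : σ = s := by
    apply hmono.injOn (by simpa [Real.dist_eq] using hσa) (by simpa [Real.dist_eq] using hsa)
    simp only [heq, inner_add_left, inner_smul_left, inner_rot_self]
    simp
  rw [hse] at heq
  have : η • rot (deriv γ s) = 0 := by simpa using heq
  exact (smul_ne_zero hη (rot_ne_zero (h.deriv_ne_zero s))) this

end IsJordanParam

/-! ### The Jordan curve theorem for `C³` curves, with orientation -/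

theorem comp_eq_of_preconnected {F C : Set Plane} (hC : IsPreconnected C) (hCF : C ⊆ F)
    {x y : Plane} (hx : x ∈ C) (hy : y ∈ C) :
    connectedComponentIn F x = connectedComponentIn F y :=
  connectedComponentIn_eq (hC.subset_connectedComponentIn hx hCF hy)

/-- The winding integral of a plane curve. -/
def wind (γ : ℝ → Plane) (L : ℝ) (r : Plane) : ℂ := windInt (toC ∘ γ) 0 L (toC r)

/-- The open segment from a nearest point avoids the curve. -/
theorem IsNearest.segment_notMem {Γ : Set Plane} {r p : Plane} (h : IsNearest Γ r p) (hr : r ∉ Γ)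
    {t : ℝ} (ht : t ∈ Ioc (0 : ℝ) 1) : p + t • (r - p) ∉ Γ := by
  intro hm
  have h1 := h.2 _ hm
  have hne : 0 < ‖r - p‖ := norm_pos_iff.2 (sub_ne_zero.2 fun h' => hr (h' ▸ h.1))
  rw [dist_eq_norm, dist_eq_norm, show r - (p + t • (r - p)) = (1 - t) • (r - p) by module,
    norm_smul, Real.norm_eq_abs, abs_of_nonneg (by linarith [ht.2])] at h1
  nlinarith [ht.1]

theorem IsNearest.unsignedDist_eq {Γ : Set Plane} {r p : Plane} (h : IsNearest Γ r p) :
    unsignedDist Γ r = dist r p :=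
  le_antisymm (Metric.infDist_le_dist_of_mem h.1) ((Metric.le_infDist ⟨p, h.1⟩).2 fun q hq => h.2 q hq)

theorem IsNearest.comp_eq {Γ : Set Plane} {r p : Plane} (h : IsNearest Γ r p) (hr : r ∉ Γ)
    {t : ℝ} (ht : t ∈ Ioc (0 : ℝ) 1) :
    connectedComponentIn Γᶜ (p + t • (r - p)) = connectedComponentIn Γᶜ r := by
  have hC : IsPreconnected ((fun t : ℝ => p + t • (r - p)) '' Ioc 0 1) :=
    isPreconnected_Ioc.image _ (by fun_prop)
  refine comp_eq_of_preconnected hC ?_ ⟨t, ht, rfl⟩ ⟨1, by simp, by simp⟩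
  rintro _ ⟨t, ht, rfl⟩
  exact h.segment_notMem hr ht

theorem exists_isNearest_of_isCompact {Γ : Set Plane} (hΓ : IsCompact Γ) (hne : Γ.Nonempty)
    (r : Plane) : ∃ p, IsNearest Γ r p := by
  obtain ⟨p, hp, h⟩ := hΓ.exists_infDist_eq_dist hne r
  exact ⟨p, hp, fun q hq => h ▸ Metric.infDist_le_dist_of_mem hq⟩

namespace IsJordanParam

variable {γ : ℝ → Plane} {L : ℝ} {Γ : Set Plane}

theorem contDiff_toC (h : IsJordanParam γ L Γ) : ContDiff ℝ 1 (toC ∘ γ) :=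
  toC.contDiff.comp (h.contDiff.of_le (by norm_num))

theorem deriv_toC (h : IsJordanParam γ L Γ) (s : ℝ) : deriv (toC ∘ γ) s = toC (deriv γ s) :=
  (toC.toContinuousLinearEquiv.toContinuousLinearMap.hasFDerivAt.comp_hasDerivAt s
    (h.hasDerivAt s)).deriv

theorem periodic_toC (h : IsJordanParam γ L Γ) : Function.Periodic (toC ∘ γ) L :=
  h.periodic.comp toC

theorem wind_eq_int (h : IsJordanParam γ L Γ) {r : Plane} (hr : r ∉ Γ) :
    ∃ n : ℤ, wind γ L r = n * (2 * Real.pi * Complex.I) :=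
  windInt_eq_int h.contDiff_toC
    (fun s hs => hr (by rw [← toC.injective hs]; exact h.mem s)) (by simpa using h.periodic_toC 0)

theorem wind_continuousOn (h : IsJordanParam γ L Γ) : ContinuousOn (wind γ L) Γᶜ :=
  (windInt_continuousOn h.contDiff_toC h.period_pos.le).comp toC.continuous.continuousOn
    fun r hr s _ hs => hr (by rw [← toC.injective hs]; exact h.mem s)

/-- A continuous function with values in `2πiℤ` is constant on preconnected sets. -/
theorem _root_.IsPreconnected.eq_of_two_pi_I_int {X : Type*} [TopologicalSpace X] {C : Set X}
    (hC : IsPreconnected C) {f : X → ℂ} (hf : ContinuousOn f C)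
    (hint : ∀ x ∈ C, ∃ n : ℤ, f x = n * (2 * Real.pi * Complex.I)) {x y : X} (hx : x ∈ C)
    (hy : y ∈ C) : f x = f y := by
  choose! n hn using hint
  have hval : ∀ x ∈ C, (f x).im / (2 * Real.pi) = n x := fun x hx => by
    rw [hn x hx]
    have := Real.pi_pos
    simp
  have hcont : ContinuousOn (fun x => (n x : ℝ)) C :=
    ((Complex.continuous_im.comp_continuousOn hf).div_const (2 * Real.pi)).congr
      fun x hx => (hval x hx).symm
  have hn' : ContinuousOn n C := by
    have := Int.isClosedEmbedding_coe_real.isInducing.continuousOn_iff (f := n) (s := C)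
    exact this.2 hcont
  rw [hn x hx, hn y hy, hC.constant hn' hx hy]

theorem wind_eq_of_comp_eq (h : IsJordanParam γ L Γ) {x y : Plane} (hy : y ∉ Γ)
    (hxy : connectedComponentIn Γᶜ x = connectedComponentIn Γᶜ y) :
    wind γ L x = wind γ L y := by
  have hyc : y ∈ connectedComponentIn Γᶜ y := mem_connectedComponentIn hy
  -- `connectedComponentIn Γᶜ x` is empty by convention when `x ∈ Γ`; equality with a nonempty
  -- component excludes this.
  have hxc : x ∈ connectedComponentIn Γᶜ x := by
    have : (connectedComponentIn Γᶜ x).Nonempty := hxy ▸ ⟨y, hyc⟩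
    exact mem_connectedComponentIn (connectedComponentIn_nonempty_iff.1 this)
  exact isPreconnected_connectedComponentIn.eq_of_two_pi_I_int
    (h.wind_continuousOn.mono (connectedComponentIn_subset _ _))
    (fun z hz => h.wind_eq_int (connectedComponentIn_subset _ _ hz)) (hxy ▸ hxc) hyc

/-- All points close to the curve on one given side lie in one component. -/
theorem exists_side (h : IsJordanParam γ L Γ) {σ : ℝ} (hσ : σ ≠ 0) :
    ∃ A : Set Plane, ∀ s, ∀ᶠ η : ℝ in 𝓝[>] 0, γ s + (σ * η) • rot (deriv γ s) ∉ Γ ∧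
      connectedComponentIn Γᶜ (γ s + (σ * η) • rot (deriv γ s)) = A := by
  have loc : ∀ s₀, ∃ b > 0, ∀ s, |s - s₀| < b → ∀ η, 0 < η → η < b → ∀ η', 0 < η' → η' < b →
      γ s + (σ * η) • rot (deriv γ s) ∉ Γ ∧
      connectedComponentIn Γᶜ (γ s + (σ * η) • rot (deriv γ s)) =
        connectedComponentIn Γᶜ (γ s₀ + (σ * η') • rot (deriv γ s₀)) := fun s₀ => by
    obtain ⟨b, hb, hoff⟩ := h.exists_collar s₀
    have hσp : 0 < |σ| := abs_pos.2 hσ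
    set b' := min b (b / |σ|)
    have hb' : 0 < b' := by positivity
    have hoff' : ∀ s, |s - s₀| < b' → ∀ η, 0 < η → η < b' →
        γ s + (σ * η) • rot (deriv γ s) ∉ Γ := fun s hs η hη hηb => by
      refine hoff s (hs.trans_le (min_le_left _ _)) _ (mul_ne_zero hσ hη.ne') ?_
      rw [abs_mul, abs_of_pos hη, mul_comm, ← lt_div_iff₀ hσp]
      exact hηb.trans_le (min_le_right _ _)
    refine ⟨b', hb', fun s hs η hη hηb η' hη' hηb' => ⟨hoff' s hs η hη hηb, ?_⟩⟩
    -- The one-sided collar is the continuous image of a rectangle and misses `Γ`, so it lies in one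
    -- component.
    have hC : IsPreconnected ((fun z : ℝ × ℝ => γ z.1 + (σ * z.2) • rot (deriv γ z.1)) ''
        (Metric.ball s₀ b' ×ˢ Ioo 0 b')) := by
      refine (((convex_ball _ _).isPreconnected).prod isPreconnected_Ioo).image _ ?_
      refine Continuous.continuousOn ((h.continuous.comp continuous_fst).add
        ((continuous_const.mul continuous_snd).smul
          (continuous_rot.comp (h.continuous_deriv.comp continuous_fst))))
    refine comp_eq_of_preconnected hC ?_ ⟨(s, η), ⟨by simpa [Real.dist_eq] using hs, hη, hηb⟩, rfl⟩
      ⟨(s₀, η'), ⟨by simpa using hb', hη', hηb'⟩, rfl⟩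
    rintro _ ⟨⟨s, η⟩, ⟨hs, hη, hηb⟩, rfl⟩
    exact hoff' s (by simpa [Real.dist_eq] using hs) η hη hηb
  choose b hb hloc using loc
  set A : ℝ → Set Plane := fun s =>
    connectedComponentIn Γᶜ (γ s + (σ * (b s / 2)) • rot (deriv γ s)) with hA
  have hev : ∀ s, ∀ᶠ η : ℝ in 𝓝[>] 0, γ s + (σ * η) • rot (deriv γ s) ∉ Γ ∧
      connectedComponentIn Γᶜ (γ s + (σ * η) • rot (deriv γ s)) = A s := fun s => by
    filter_upwards [Ioo_mem_nhdsGT (hb s)] with η hη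
    exact hloc s s (by simpa using hb s) η hη.1 hη.2 _ (half_pos (hb s)) (half_lt_self (hb s))
  -- Overlapping collars share a component, and the parameter line is connected.
  have hconst : IsLocallyConstant A := by
    rw [IsLocallyConstant.iff_eventually_eq]
    intro s₀
    filter_upwards [Metric.ball_mem_nhds s₀ (hb s₀)] with s hs
    obtain ⟨η, hη, hηb⟩ := ((hev s).and (Ioo_mem_nhdsGT (hb s₀))).exists
    rw [← hη.2]
    exact (hloc s₀ s (by simpa [Real.dist_eq] using hs) η hηb.1 hηb.2 _ (half_pos (hb s₀))
      (half_lt_self (hb s₀))).2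
  refine ⟨A 0, fun s => ?_⟩
  rw [hconst.apply_eq_of_preconnectedSpace 0 s]
  exact hev s

/-- First variation: the squared distance to `r` is minimal along the curve at `s`. -/
theorem inner_eq_zero_of_isNearest (h : IsJordanParam γ L Γ) {r : Plane} {s : ℝ}
    (hn : IsNearest Γ r (γ s)) : (inner ℝ (r - γ s) (deriv γ s) : ℝ) = 0 := by
  have hd : HasDerivAt (fun s => ‖r - γ s‖ ^ 2) (2 * inner ℝ (r - γ s) (-deriv γ s)) s :=
    ((h.hasDerivAt s).const_sub r).norm_sq
  have hmin : IsLocalMin (fun s => ‖r - γ s‖ ^ 2) s := Eventually.of_forall fun s' => by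
    have := hn.2 _ (h.mem s')
    rw [dist_eq_norm, dist_eq_norm] at this
    exact pow_le_pow_left₀ (norm_nonneg _) this 2
  have := hmin.hasDerivAt_eq_zero hd
  rw [inner_neg_right] at this
  linarith

/-- A point off the curve is joined to the side of the curve on which it lies with respect to a
nearest point. -/
theorem comp_eq_side (h : IsJordanParam γ L Γ) {σ : ℝ} {A : Set Plane}
    (hA : ∀ s, ∀ᶠ η : ℝ in 𝓝[>] 0, γ s + (σ * η) • rot (deriv γ s) ∉ Γ ∧
      connectedComponentIn Γᶜ (γ s + (σ * η) • rot (deriv γ s)) = A)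
    {r : Plane} (hr : r ∉ Γ) {s : ℝ} (hn : IsNearest Γ r (γ s))
    (hpos : 0 < σ * (inner ℝ (r - γ s) (rot (deriv γ s)) : ℝ)) :
    connectedComponentIn Γᶜ r = A := by
  set v := deriv γ s
  have hv : 0 < ‖v‖ := norm_pos_iff.2 (h.deriv_ne_zero s)
  have hrep := eq_smul_rot (h.deriv_ne_zero s) (h.inner_eq_zero_of_isNearest hn)
  set c : ℝ := inner ℝ (r - γ s) (rot v) / ‖v‖ ^ 2 with hc
  have hσc : 0 < σ * c := by rw [hc, ← mul_div_assoc]; positivity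
  have hc0 : c ≠ 0 := by rintro h0; simp [h0] at hσc
  have hq : 0 < σ / c := by
    rw [show σ / c = σ * c / c ^ 2 by field_simp]; positivity
  -- Since `r - γ s = c • rot v`, the point at fraction `σ / c * η` of the segment towards `r` is
  -- the collar point `γ s + (σ * η) • rot v`; the bound on `η` keeps the fraction at most `1`.
  obtain ⟨η, hη, hηb⟩ := ((hA s).and (Ioo_mem_nhdsGT (inv_pos.2 hq))).exists
  rw [← hη.2, ← hn.comp_eq hr (t := σ / c * η) ⟨by have := hηb.1; positivity, ?_⟩, hrep, smul_smul]
  · rw [show σ / c * η * c = σ * η by field_simp]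
  · have := mul_lt_mul_of_pos_left hηb.2 hq
    rw [mul_inv_cancel₀ hq.ne'] at this
    exact this.le

/-- The winding integral vanishes far away. -/
theorem exists_wind_eq_zero (h : IsJordanParam γ L Γ) :
    ∃ R : ℝ, 0 < R ∧ ∀ r : Plane, R ≤ ‖r‖ → r ∉ Γ ∧ wind γ L r = 0 := by
  obtain ⟨B, hB⟩ := h.isCompact.isBounded.exists_norm_le
  obtain ⟨C, hC⟩ := (isCompact_Icc (a := (0 : ℝ)) (b := L)).exists_bound_of_continuousOn
    h.continuous_deriv.continuousOn
  have hL := h.period_pos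
  have hC0 : 0 ≤ C := (norm_nonneg _).trans (hC 0 ⟨le_rfl, hL.le⟩)
  have hB0 : 0 ≤ B := (norm_nonneg _).trans (hB _ (h.mem 0))
  -- This radius keeps `r` at distance at least `C * L + 1` from the curve, so the integral is at
  -- most `C * L / (C * L + 1) < 1 < 2π` in norm.
  refine ⟨B + C * L + 1, by positivity, fun r hr => ?_⟩
  have hCL : 0 ≤ C * L := by positivity
  have hoff : r ∉ Γ := fun hm => by linarith [hB r hm]
  refine ⟨hoff, ?_⟩
  have hle : ‖wind γ L r‖ ≤ C / (C * L + 1) * |L - 0| := by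
    refine intervalIntegral.norm_integral_le_of_norm_le_const fun s hs => ?_
    rw [uIoc_of_le hL.le] at hs
    rw [h.deriv_toC, Function.comp_apply, ← map_sub, norm_div, toC.norm_map, toC.norm_map]
    gcongr
    · exact hC s ⟨hs.1.le, hs.2⟩
    · have := norm_sub_norm_le r (γ s)
      rw [norm_sub_rev]
      linarith [hB _ (h.mem s)]
  have hlt : C / (C * L + 1) * |L - 0| < 1 := by
    rw [sub_zero, abs_of_pos hL, div_mul_eq_mul_div, div_lt_one (by positivity)]
    linarith
  refine eq_of_two_pi_I_int (h.wind_eq_int hoff) ⟨0, by simp⟩ ?_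
  rw [sub_zero]
  linarith [Real.pi_gt_three]

theorem wind_jump (h : IsJordanParam γ L Γ) (s : ℝ) : ∀ᶠ η : ℝ in 𝓝[>] 0,
    wind γ L (γ s + η • rot (deriv γ s)) - wind γ L (γ s - η • rot (deriv γ s)) =
      2 * Real.pi * Complex.I := by
  obtain ⟨b, hb, hoff⟩ := h.exists_collar s
  have e1 : ∀ η : ℝ, toC (γ s + η • rot (deriv γ s)) =
      (toC ∘ γ) s + η * (Complex.I * deriv (toC ∘ γ) s) := fun η => by
    simp [h.deriv_toC, toC_rot]
  have e2 : ∀ η : ℝ, toC (γ s - η • rot (deriv γ s)) =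
      (toC ∘ γ) s - η * (Complex.I * deriv (toC ∘ γ) s) := fun η => by
    simp [h.deriv_toC, toC_rot]
  have hj := windInt_jump h.contDiff_toC h.period_pos h.periodic_toC (s₀ := s)
    (by rw [h.deriv_toC]; simpa using h.deriv_ne_zero s)
    (fun σ hσ heq => h.eq_of_mem_Icc hσ (toC.injective heq)) (by
      filter_upwards [Ioo_mem_nhdsGT hb] with η hη σ
      rw [← e1, ← e2]
      have hη' : |η| < b := by rw [abs_of_pos hη.1]; exact hη.2
      constructor
      · intro heq
        exact hoff s (by simpa using hb) η hη.1.ne' hη' (toC.injective heq ▸ h.mem σ)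
      · intro heq
        refine hoff s (by simpa using hb) (-η) (neg_ne_zero.2 hη.1.ne') (by rwa [abs_neg]) ?_
        rw [neg_smul, ← sub_eq_add_neg]
        exact toC.injective heq ▸ h.mem σ)
  filter_upwards [hj] with η hη
  rw [wind, wind, e1, e2]
  exact hη

theorem inside_congr {x y : Plane} (hx : x ∉ Γ) (hy : y ∉ Γ)
    (hxy : connectedComponentIn Γᶜ x = connectedComponentIn Γᶜ y) :
    x ∈ inside Γ ↔ y ∈ inside Γ := by
  simp only [inside, mem_ofPred_eq, mem_compl_iff, hx, hy, hxy]

/-- An unbounded component reaches the region where the winding integral vanishes, and the integral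
is constant on it. -/
theorem wind_eq_zero_of_notMem_inside (h : IsJordanParam γ L Γ) {r : Plane} (hr : r ∉ Γ)
    (hi : r ∉ inside Γ) : wind γ L r = 0 := by
  obtain ⟨R, hR, hfar⟩ := h.exists_wind_eq_zero
  have hub : ¬ Bornology.IsBounded (connectedComponentIn Γᶜ r) := fun hb => hi ⟨hr, hb⟩
  have : ∃ y ∈ connectedComponentIn Γᶜ r, R ≤ ‖y‖ := by
    by_contra! hcon
    exact hub (isBounded_iff_forall_norm_le.2 ⟨R, fun y hy => (hcon y hy).le⟩)
  obtain ⟨y, hy, hyR⟩ := this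
  rw [h.wind_eq_of_comp_eq (hfar y hyR).1 (connectedComponentIn_eq hy)]
  exact (hfar y hyR).2

/-- A ray outside a large disc avoids the curve and makes its component unbounded. -/
theorem exists_notMem_inside (h : IsJordanParam γ L Γ) : ∃ r, r ∉ Γ ∧ r ∉ inside Γ := by
  obtain ⟨R, hR, hfar⟩ := h.exists_wind_eq_zero
  set e : Plane := EuclideanSpace.single 0 1
  have he : ‖e‖ = 1 := by simp [e]
  have hray : (fun t : ℝ => t • e) '' Ici R ⊆ Γᶜ := by
    rintro _ ⟨t, ht, rfl⟩
    refine (hfar _ ?_).1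
    rw [norm_smul, he, mul_one]
    exact (le_abs_self t).trans' ht
  refine ⟨R • e, hray ⟨R, self_mem_Ici, rfl⟩, fun hi => ?_⟩
  have hsub := (isPreconnected_Ici.image (fun t : ℝ => t • e)
    (by fun_prop : Continuous _).continuousOn).subset_connectedComponentIn
    ⟨R, self_mem_Ici, rfl⟩ hray
  obtain ⟨B, hB⟩ := (hi.2.subset hsub).exists_norm_le
  have := hB _ ⟨max R (B + 1), mem_Ici.2 (le_max_left _ _), rfl⟩
  rw [norm_smul, he, mul_one, Real.norm_eq_abs] at this
  have := le_abs_self (max R (B + 1))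
  linarith [le_max_right R (B + 1)]

end IsJordanParam

/-- `ε = 1` if `γ` runs counterclockwise around `Γ`, `ε = -1` if it runs clockwise. -/
structure IsOrientation (γ : ℝ → Plane) (L : ℝ) (Γ : Set Plane) (ε : ℝ) : Prop where
  eq_or : ε = 1 ∨ ε = -1
  wind_inside : ∀ r ∈ inside Γ, wind γ L r = ε * (2 * Real.pi * Complex.I)
  mem_inside : ∀ s, ∀ᶠ η : ℝ in 𝓝[>] 0, γ s + (ε * η) • rot (deriv γ s) ∈ inside Γ
  notMem_inside : ∀ s, ∀ᶠ η : ℝ in 𝓝[>] 0, γ s + (-ε * η) • rot (deriv γ s) ∉ inside Γ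
  mem_inside_of_pos : ∀ r s, IsNearest Γ r (γ s) → r ∉ Γ →
    0 < ε * (inner ℝ (r - γ s) (rot (deriv γ s)) : ℝ) → r ∈ inside Γ
  notMem_inside_of_neg : ∀ r s, IsNearest Γ r (γ s) → r ∉ Γ →
    ε * (inner ℝ (r - γ s) (rot (deriv γ s)) : ℝ) < 0 → r ∉ inside Γ

namespace IsJordanParam

variable {γ : ℝ → Plane} {L : ℝ} {Γ : Set Plane}

theorem inner_ne_zero (h : IsJordanParam γ L Γ) {r : Plane} {s : ℝ} (hr : r ∉ Γ)
    (hn : IsNearest Γ r (γ s)) : (inner ℝ (r - γ s) (rot (deriv γ s)) : ℝ) ≠ 0 := by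
  intro h0
  have := eq_smul_rot (h.deriv_ne_zero s) (h.inner_eq_zero_of_isNearest hn)
  rw [h0, zero_div, zero_smul, sub_eq_zero] at this
  exact hr (this ▸ hn.1)

/-- A side of the curve is inside if the other one is outside and carries winding number `0`. -/
theorem isOrientation_of_side (h : IsJordanParam γ L Γ) {ε : ℝ} (hε : ε = 1 ∨ ε = -1)
    {A B : Set Plane}
    (hA : ∀ s, ∀ᶠ η : ℝ in 𝓝[>] 0, γ s + (ε * η) • rot (deriv γ s) ∉ Γ ∧
      connectedComponentIn Γᶜ (γ s + (ε * η) • rot (deriv γ s)) = A)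
    (hB : ∀ s, ∀ᶠ η : ℝ in 𝓝[>] 0, γ s + (-ε * η) • rot (deriv γ s) ∉ Γ ∧
      connectedComponentIn Γᶜ (γ s + (-ε * η) • rot (deriv γ s)) = B)
    {r₀ : Plane} (hr₀ : r₀ ∉ Γ) (hi₀ : r₀ ∉ inside Γ) (hc₀ : connectedComponentIn Γᶜ r₀ = B) :
    IsOrientation γ L Γ ε := by
  have hout : ∀ r, r ∉ Γ → connectedComponentIn Γᶜ r = B → r ∉ inside Γ := fun r hr hc => by
    rwa [inside_congr hr hr₀ (hc.trans hc₀.symm)]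
  have hw : ∀ r, r ∉ Γ → connectedComponentIn Γᶜ r = A →
      wind γ L r = ε * (2 * Real.pi * Complex.I) := fun r hr hc => by
    -- A single `η` serves both sides at `s = 0`: the outer value is `0`, so the jump determines the
    -- value on the other side.
    obtain ⟨η, ⟨⟨hj, ha⟩, hb⟩⟩ := (((h.wind_jump 0).and (hA 0)).and (hB 0)).exists
    have wb : wind γ L (γ 0 + (-ε * η) • rot (deriv γ 0)) = 0 :=
      h.wind_eq_zero_of_notMem_inside hb.1 (hout _ hb.1 hb.2)
    have wa := h.wind_eq_of_comp_eq ha.1 (hc.trans ha.2.symm)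
    rcases hε with rfl | rfl
    · simp only [one_mul, neg_mul, neg_smul, ← sub_eq_add_neg] at wa wb ⊢
      rw [wb] at hj
      rw [wa, ← sub_zero (wind γ L _), hj]; simp
    · simp only [one_mul, neg_mul, neg_neg, neg_smul, ← sub_eq_add_neg] at wa wb ⊢
      rw [wb] at hj
      rw [wa]; push_cast; linear_combination -hj
  have hin : ∀ r, r ∉ Γ → connectedComponentIn Γᶜ r = A → r ∈ inside Γ := fun r hr hc => by
    by_contra hcon
    have h1 := hw r hr hc
    rw [h.wind_eq_zero_of_notMem_inside hr hcon] at h1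
    rcases hε with rfl | rfl <;> simp [Real.pi_ne_zero] at h1
  refine ⟨hε, fun r hr => ?_, fun s => (hA s).mono fun η hη => hin _ hη.1 hη.2,
    fun s => (hB s).mono fun η hη => hout _ hη.1 hη.2, fun r s hn hr hpos => ?_,
    fun r s hn hr hneg => ?_⟩
  · obtain ⟨p, hp⟩ := exists_isNearest_of_isCompact h.isCompact h.nonempty r
    obtain ⟨s, -, rfl⟩ := h.exists_param hp.1 0
    have hrΓ : r ∉ Γ := hr.1
    rcases (mul_ne_zero (by rcases hε with rfl | rfl <;> norm_num)
      (h.inner_ne_zero hrΓ hp) : ε * _ ≠ 0).lt_or_gt with hlt | hgt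
    · exact absurd hr (hout r hrΓ (h.comp_eq_side hB hrΓ hp (by rw [neg_mul]; linarith)))
    · exact hw r hrΓ (h.comp_eq_side hA hrΓ hp hgt)
  · exact hin r hr (h.comp_eq_side hA hr hn hpos)
  · exact hout r hr (h.comp_eq_side hB hr hn (by rw [neg_mul]; linarith))

/-- The Jordan curve theorem for `C³` curves: one side of the curve is inside, the other not. -/
theorem exists_isOrientation (h : IsJordanParam γ L Γ) : ∃ ε, IsOrientation γ L Γ ε := by
  obtain ⟨A, hA⟩ := h.exists_side (σ := 1) one_ne_zero
  obtain ⟨B, hB⟩ := h.exists_side (σ := -1) (by norm_num)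
  obtain ⟨r₀, hr₀, hi₀⟩ := h.exists_notMem_inside
  obtain ⟨p, hp⟩ := exists_isNearest_of_isCompact h.isCompact h.nonempty r₀
  obtain ⟨s, -, rfl⟩ := h.exists_param hp.1 0
  -- The side on which the outer point `r₀` lies is the outer side.
  rcases (h.inner_ne_zero hr₀ hp).lt_or_gt with hlt | hgt
  · exact ⟨1, h.isOrientation_of_side (Or.inl rfl) hA hB hr₀ hi₀
      (h.comp_eq_side hB hr₀ hp (by linarith))⟩
  · exact ⟨-1, h.isOrientation_of_side (Or.inr rfl) hB (by simpa using hA) hr₀ hi₀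
      (h.comp_eq_side hA hr₀ hp (by linarith))⟩

end IsJordanParam

namespace IsOrientation

variable {γ : ℝ → Plane} {L : ℝ} {Γ : Set Plane} {ε : ℝ}

/-- This replaces a statement about components, which is hard to follow in time, by one about a
continuous integral. -/
theorem mem_inside_iff (ho : IsOrientation γ L Γ ε) (h : IsJordanParam γ L Γ) {r : Plane}
    (hr : r ∉ Γ) : r ∈ inside Γ ↔ wind γ L r ≠ 0 := by
  refine ⟨fun hi => ?_, fun hw => by_contra fun hi => hw (h.wind_eq_zero_of_notMem_inside hr hi)⟩
  rw [ho.wind_inside r hi]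
  refine mul_ne_zero ?_ Complex.two_pi_I_ne_zero
  rcases ho.eq_or with rfl | rfl <;> norm_num

theorem inside_nonempty (ho : IsOrientation γ L Γ ε) : (inside Γ).Nonempty :=
  let ⟨_, hη⟩ := (ho.mem_inside 0).exists
  ⟨_, hη⟩

/-- `r - γ s` is normal to the curve and the orientation fixes its sign. Unlike the unsigned
distance, the resulting expression is smooth across the curve. -/
theorem signedDist_eq (ho : IsOrientation γ L Γ ε) (h : IsJordanParam γ L Γ) {r : Plane} {s : ℝ}
    (hn : IsNearest Γ r (γ s)) :
    signedDist Γ r = -ε * inner ℝ (r - γ s) (rot (deriv γ s)) / ‖deriv γ s‖ := by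
  have hv : 0 < ‖deriv γ s‖ := norm_pos_iff.2 (h.deriv_ne_zero s)
  have hrep := eq_smul_rot (h.deriv_ne_zero s) (h.inner_eq_zero_of_isNearest hn)
  set c : ℝ := inner ℝ (r - γ s) (rot (deriv γ s)) with hc
  have hδ : unsignedDist Γ r = |c| / ‖deriv γ s‖ := by
    rw [hn.unsignedDist_eq, dist_eq_norm, hrep, norm_smul, norm_rot, norm_div, norm_pow, norm_norm,
      Real.norm_eq_abs]
    field_simp
  have hεa : |ε * c| = |c| := by
    rw [abs_mul]; rcases ho.eq_or with rfl | rfl <;> simp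
  by_cases hr : r ∈ Γ
  · have h0 : unsignedDist Γ r = 0 := Metric.infDist_zero_of_mem hr
    have hni : r ∉ inside Γ := fun hi => hi.1 hr
    rw [signedDist, if_neg hni, h0]
    rw [h0] at hδ
    have : c = 0 := by
      by_contra hcne
      have := abs_pos.2 hcne
      have : 0 < |c| / ‖deriv γ s‖ := by positivity
      linarith
    rw [this]; simp
  · rcases (mul_ne_zero (by rcases ho.eq_or with rfl | rfl <;> norm_num)
      (h.inner_ne_zero hr hn) : ε * c ≠ 0).lt_or_gt with hlt | hgt
    · rw [signedDist, if_neg (ho.notMem_inside_of_neg r s hn hr hlt), hδ, ← hεa, abs_of_neg hlt]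
      ring
    · rw [signedDist, if_pos (ho.mem_inside_of_pos r s hn hr hgt), hδ, ← hεa, abs_of_pos hgt]
      ring

end IsOrientation

namespace IsJordanParam

variable {γ : ℝ → Plane} {L : ℝ} {Γ : Set Plane}

theorem comp_neg (h : IsJordanParam γ L Γ) : IsJordanParam (fun s => γ (-s)) L Γ where
  period_pos := h.period_pos
  contDiff := h.contDiff.comp contDiff_neg
  deriv_ne_zero s := by
    rw [deriv_comp_neg]; exact neg_ne_zero.2 (h.deriv_ne_zero _)
  periodic s := by
    change γ (-(s + L)) = γ (-s)
    rw [neg_add, ← sub_eq_add_neg, h.periodic.sub_eq]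
  injOn := by
    intro s hs t ht heq
    -- Reflection sends `[0, L)` to `(-L, 0]`, so injectivity is used in its form for parameters
    -- less than `L` apart.
    refine neg_injective (h.eq_of_abs_lt ?_ heq)
    rw [abs_lt]
    constructor <;> linarith [hs.1, hs.2, ht.1, ht.2]
  range_eq := by
    rw [← h.range_eq]
    exact (Equiv.neg ℝ).surjective.range_comp γ

theorem exists_isCounterclockwiseParam (h : IsJordanParam γ L Γ) :
    ∃ γ', IsCounterclockwiseParam γ' L Γ := by
  obtain ⟨ε, ho⟩ := h.exists_isOrientation
  rcases ho.eq_or with rfl | rfl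
  · exact ⟨γ, h, fun s => by simpa using ho.mem_inside s⟩
  · refine ⟨fun s => γ (-s), h.comp_neg, fun s => ?_⟩
    have hr : ∀ v : Plane, rot (-v) = -rot v := fun v => by
      rw [← rotL_apply, map_neg, rotL_apply]
    simpa [deriv_comp_neg, hr] using ho.mem_inside (-s)

end IsJordanParam

theorem IsCounterclockwiseParam.isOrientation {γ : ℝ → Plane} {L : ℝ} {Γ : Set Plane}
    (h : IsCounterclockwiseParam γ L Γ) : IsOrientation γ L Γ 1 := by
  obtain ⟨ε, ho⟩ := h.toIsJordanParam.exists_isOrientation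
  rcases ho.eq_or with rfl | rfl
  · exact ho
  · obtain ⟨η, h1, h2⟩ := ((h.inside_left 0).and (ho.notMem_inside 0)).exists
    simp only [neg_neg, one_mul] at h2
    exact absurd h1 h2

/-- A unique minimizer over a compact set depends continuously on the parameter. -/
theorem continuousWithinAt_argmin {X Y : Type*} [TopologicalSpace X] [TopologicalSpace Y]
    {K : Set Y} (hK : IsCompact K) {S : Set X} {f : X → Y → ℝ}
    (hf : ContinuousOn (fun z : X × Y => f z.1 z.2) (S ×ˢ K)) {m : X → Y}
    (hmK : ∀ x ∈ S, m x ∈ K) (hmin : ∀ x ∈ S, ∀ y ∈ K, f x (m x) ≤ f x y) {x₁ : X} (hx₁ : x₁ ∈ S)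
    (huniq : ∀ y ∈ K, f x₁ y ≤ f x₁ (m x₁) → y = m x₁) : ContinuousWithinAt m S x₁ := by
  refine hK.tendsto_nhds_of_unique_mapClusterPt
    (eventually_nhdsWithin_of_forall hmK) fun y hy hcl => huniq y hy ?_
  -- If a cluster point `y` had a larger value, a level `c` would separate it from the minimum:
  -- nearby, `f x (m x) > c > f x (m x₁)`, against minimality.
  by_contra! hlt
  obtain ⟨c, hc1, hc2⟩ := exists_between hlt
  have h1 : ∀ᶠ z in 𝓝[S ×ˢ K] (x₁, y), c < f z.1 z.2 :=
    (hf (x₁, y) ⟨hx₁, hy⟩).eventually_const_lt hc2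
  rw [nhdsWithin_prod_eq] at h1
  obtain ⟨U, hU, V, hV, hUV⟩ := mem_prod_iff.1 h1
  have h2 : ∀ᶠ z in 𝓝[S ×ˢ K] (x₁, m x₁), f z.1 z.2 < c :=
    (hf (x₁, m x₁) ⟨hx₁, hmK x₁ hx₁⟩).eventually_lt_const hc1
  have h3 : Tendsto (fun x => (x, m x₁)) (𝓝[S] x₁) (𝓝[S ×ˢ K] (x₁, m x₁)) := by
    rw [nhdsWithin_prod_eq]
    exact tendsto_id.prodMk (tendsto_const_pure.mono_right (pure_le_nhdsWithin (hmK x₁ hx₁)))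
  obtain ⟨V', hV', hVV⟩ := mem_nhdsWithin_iff_exists_mem_nhds_inter.1 hV
  obtain ⟨x, hxV, ⟨hxU, hxc⟩, hxS⟩ := ((hcl.frequently hV').and_eventually
    ((Filter.Eventually.and hU (h3.eventually h2)).and self_mem_nhdsWithin)).exists
  have := @hUV (x, m x) ⟨hxU, hVV ⟨hxV, hmK x hxS⟩⟩
  have h4 := hmin x hxS (m x₁) (hmK x₁ hx₁)
  simp only [mem_ofPred_eq] at this hxc
  linarith

/-! ### Curvature and the second variation of the distance -/

namespace IsJordanParam

variable {γ : ℝ → Plane} {L : ℝ} {Γ : Set Plane}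

theorem hasDerivAt_deriv (h : IsJordanParam γ L Γ) (s : ℝ) :
    HasDerivAt (deriv γ) (deriv (deriv γ) s) s := by
  have h2 : ContDiff ℝ 2 (deriv γ) := by
    have := h.contDiff
    rw [show (3 : WithTop ℕ∞) = 2 + 1 by norm_num, contDiff_succ_iff_deriv] at this
    exact this.2.2
  exact (h2.differentiable (by norm_num) s).hasDerivAt

theorem tendsto_param (h : IsJordanParam γ L Γ) (s₀ : ℝ) :
    Tendsto γ (𝓝[≠] s₀) (𝓝[Γ \ {γ s₀}] γ s₀) := by
  refine tendsto_nhdsWithin_iff.2 ⟨(h.continuous.tendsto s₀).mono_left nhdsWithin_le_nhds, ?_⟩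
  filter_upwards [self_mem_nhdsWithin,
    mem_nhdsWithin_of_mem_nhds (Metric.ball_mem_nhds s₀ h.period_pos)] with s hs hL
  exact ⟨h.mem s, fun heq => hs (h.eq_of_abs_lt (by simpa [Real.dist_eq] using hL) heq)⟩

/-- Limits in the parameter become limits along the set `Γ`, which do not depend on the
parametrization. -/
theorem nhdsWithin_le_map (h : IsJordanParam γ L Γ) (s₀ : ℝ) :
    𝓝[Γ \ {γ s₀}] γ s₀ ≤ map γ (𝓝[≠] s₀) := by
  intro U hU
  rw [mem_map, Metric.mem_nhdsWithin_iff] at hU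
  obtain ⟨a, ha, hU⟩ := hU
  obtain ⟨ρ, hρ, hnear⟩ := h.exists_dist_lt s₀ ha
  rw [Metric.mem_nhdsWithin_iff]
  refine ⟨ρ, hρ, ?_⟩
  rintro q ⟨hq, hqΓ, hne⟩
  obtain ⟨s, hs, rfl⟩ := h.exists_param hqΓ s₀
  exact hU ⟨by simpa [Real.dist_eq] using hnear s hs hq, fun heq => hne (by rw [heq]; rfl)⟩

/-- The second variation of the squared distance along the curve, as an intrinsic limit. -/
theorem tendsto_second_variation (h : IsJordanParam γ L Γ) {r : Plane} {s₀ : ℝ}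
    (horth : (inner ℝ (γ s₀ - r) (deriv γ s₀) : ℝ) = 0) :
    Tendsto (fun q => 2 * (inner ℝ (γ s₀ - r) (q - γ s₀) : ℝ) / ‖q - γ s₀‖ ^ 2)
      (𝓝[Γ \ {γ s₀}] γ s₀)
      (𝓝 (inner ℝ (γ s₀ - r) (deriv (deriv γ) s₀) / ‖deriv γ s₀‖ ^ 2)) := by
  refine Tendsto.mono_left ?_ (h.nhdsWithin_le_map s₀)
  rw [tendsto_map'_iff]
  set w := γ s₀ - r
  have hd : ∀ s, HasDerivAt (fun s => 2 * (inner ℝ w (γ s - γ s₀) : ℝ))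
      (2 * inner ℝ w (deriv γ s)) s := fun s => by
    have := (((hasDerivAt_const s w).inner ℝ ((h.hasDerivAt s).sub_const (γ s₀)))).const_mul 2
    simpa using this
  have hd2 : ∀ s, HasDerivAt (fun s => (s - s₀) ^ 2) (2 * (s - s₀)) s := fun s => by
    simpa using ((hasDerivAt_id s).sub_const s₀).fun_pow 2
  have hdd : HasDerivAt (fun s => (inner ℝ w (deriv γ s) : ℝ))
      (inner ℝ w (deriv (deriv γ) s₀)) s₀ := by
    simpa using (hasDerivAt_const s₀ w).inner ℝ (h.hasDerivAt_deriv s₀)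
  -- By L'Hôpital the quotient of derivatives is `⟪w, γ' s⟫ / (s - s₀)`, a difference quotient
  -- because `⟪w, γ' s₀⟫ = 0`.
  have hnum : Tendsto (fun s => 2 * (inner ℝ w (γ s - γ s₀) : ℝ) / (s - s₀) ^ 2) (𝓝[≠] s₀)
      (𝓝 (inner ℝ w (deriv (deriv γ) s₀))) := by
    refine HasDerivAt.lhopital_zero_nhdsNE (Eventually.of_forall hd) (Eventually.of_forall hd2)
      ?_ ?_ ?_ ?_
    · filter_upwards [self_mem_nhdsWithin] with s hs
      exact mul_ne_zero two_ne_zero (sub_ne_zero.2 hs)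
    · simpa using (hd s₀).continuousAt.tendsto.mono_left nhdsWithin_le_nhds
    · simpa using (hd2 s₀).continuousAt.tendsto.mono_left nhdsWithin_le_nhds
    · refine (hasDerivAt_iff_tendsto_slope.1 hdd).congr fun s => ?_
      rw [slope_def_field, horth, sub_zero, mul_div_mul_left _ _ two_ne_zero]
  have hden : Tendsto (fun s => ‖slope γ s₀ s‖ ^ 2) (𝓝[≠] s₀) (𝓝 (‖deriv γ s₀‖ ^ 2)) :=
    ((hasDerivAt_iff_tendsto_slope.1 (h.hasDerivAt s₀)).norm).pow 2
  refine (hnum.div hden (pow_ne_zero _ (norm_ne_zero_iff.2 (h.deriv_ne_zero s₀)))).congr' ?_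
  filter_upwards [self_mem_nhdsWithin] with s hs
  have hs' : (s - s₀) ^ 2 ≠ 0 := pow_ne_zero _ (sub_ne_zero.2 hs)
  simp only [Function.comp_apply, Pi.div_apply]
  rw [slope_def_module, norm_smul, mul_pow, norm_inv, inv_pow, Real.norm_eq_abs, sq_abs, div_div,
    ← mul_assoc, mul_inv_cancel₀ hs', one_mul]

/-- The second variation of the squared distance in terms of the signed curvature. -/
theorem second_variation_eq (h : IsJordanParam γ L Γ) {r : Plane} {s : ℝ}
    (hn : IsNearest Γ r (γ s)) :
    ‖deriv γ s‖ ^ 2 + inner ℝ (γ s - r) (deriv (deriv γ) s) =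
      ‖deriv γ s‖ ^ 2 * (1 + signedCurvature Γ (γ s) * signedDist Γ r) := by
  have hex : ∃ κ, IsSignedCurvature Γ (γ s) κ := by
    obtain ⟨γ', h'⟩ := h.exists_isCounterclockwiseParam
    obtain ⟨s', -, hs'⟩ := h'.exists_param hn.1 0
    exact ⟨_, γ', L, s', h', hs', rfl⟩
  obtain ⟨γ', L', s', h', hs', hκ⟩ := Classical.epsilon_spec hex
  have hn' : IsNearest Γ r (γ' s') := hs' ▸ hn
  have horth : ∀ {γ : ℝ → Plane} {L s : ℝ}, IsJordanParam γ L Γ → IsNearest Γ r (γ s) →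
      (inner ℝ (γ s - r) (deriv γ s) : ℝ) = 0 := fun h hn => by
    rw [← neg_sub, inner_neg_left, h.inner_eq_zero_of_isNearest hn, neg_zero]
  have l1 := h.tendsto_second_variation (horth h hn)
  have l2 := h'.tendsto_second_variation (horth h'.toIsJordanParam hn')
  rw [hs'] at l2
  have : (𝓝[Γ \ {γ s}] γ s).NeBot := (h.tendsto_param s).neBot
  -- The parametrization behind `signedCurvature` is an arbitrary counterclockwise one, possibly
  -- unrelated to `γ`; the intrinsic limit transfers its second variation to `γ`.
  have heq := tendsto_nhds_unique l1 l2
  have hv : ‖deriv γ s‖ ≠ 0 := norm_ne_zero_iff.2 (h.deriv_ne_zero s)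
  have hv' : ‖deriv γ' s'‖ ≠ 0 := norm_ne_zero_iff.2 (h'.deriv_ne_zero s')
  have hrep := eq_smul_rot (h'.deriv_ne_zero s')
    (h'.toIsJordanParam.inner_eq_zero_of_isNearest hn')
  have hd := h'.isOrientation.signedDist_eq h'.toIsJordanParam hn'
  rw [signedCurvature, hκ, hd]
  rw [hs'] at hrep ⊢
  set c : ℝ := inner ℝ (r - γ s) (rot (deriv γ' s'))
  have h1 : (inner ℝ (γ s - r) (deriv (deriv γ') s') : ℝ) =
      -(c / ‖deriv γ' s'‖ ^ 2 * inner ℝ (rot (deriv γ' s')) (deriv (deriv γ') s')) := by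
    rw [← neg_sub r (γ s), hrep, inner_neg_left, real_inner_smul_left]
  rw [h1, div_eq_iff (pow_ne_zero _ hv)] at heq
  rw [heq]
  field_simp

end IsJordanParam

/-! ### Families of Jordan curves -/

/-- A `C³` family of regular parametrizations, for times in `J`, of Jordan curves `Γ t`. -/
structure IsCurveFamily (g : ℝ × ℝ → Plane) (L : ℝ) (J : Set ℝ) (Γ : ℝ → Set Plane) : Prop where
  uniqueDiffOn : UniqueDiffOn ℝ J
  contDiffOn : ContDiffOn ℝ 3 g (univ ×ˢ J)
  isJordanParam : ∀ t ∈ J, IsJordanParam (fun s => g (s, t)) L (Γ t)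

theorem IsConfiguration.exists_isCurveFamily {Γref O : Set Plane} {J : Set ℝ}
    {Φ : Plane × ℝ → Plane} (hJ : J = univ ∨ J = Ici 0) (h : IsConfiguration Γref O J Φ) :
    ∃ g L, IsCurveFamily g L J (curve Γref Φ) := by
  obtain ⟨γ, L, hγ⟩ := h.jordan
  have hO : ∀ s, γ s ∈ O := fun s => h.subset (hγ.mem s)
  have hslice : ∀ t ∈ J, ContDiffOn ℝ 3 (fun x => Φ (x, t)) O := fun t ht =>
    h.contDiffOn.comp (by fun_prop) fun x hx => ⟨hx, ht⟩
  refine ⟨fun z => Φ (γ z.1, z.2), L, ?_, ?_, fun t ht => ?_⟩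
  · rcases hJ with rfl | rfl
    · exact uniqueDiffOn_univ
    · exact uniqueDiffOn_Ici 0
  · have : ContDiff ℝ 3 fun z : ℝ × ℝ => (γ z.1, z.2) :=
      (hγ.contDiff.comp contDiff_fst).prodMk contDiff_snd
    exact h.contDiffOn.comp this.contDiffOn fun z hz => ⟨hO _, hz.2⟩
  · refine ⟨hγ.period_pos, ?_, fun s => ?_, fun s => ?_, fun s hs s' hs' heq => ?_, ?_⟩
    · rw [← contDiffOn_univ]
      exact (hslice t ht).comp hγ.contDiff.contDiffOn fun s _ => hO s
    · have hd : DifferentiableAt ℝ (fun x => Φ (x, t)) (γ s) :=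
        ((hslice t ht).differentiableOn (by norm_num)).differentiableAt (h.isOpen.mem_nhds (hO s))
      have hc : HasDerivAt (fun s => Φ (γ s, t)) (jacobian Φ (γ s) t (deriv γ s)) s :=
        hd.hasFDerivAt.comp_hasDerivAt s (hγ.hasDerivAt s)
      rw [hc.deriv]
      obtain ⟨e, he⟩ := h.isInvertible t ht _ (hO s)
      rw [← he]
      simpa using hγ.deriv_ne_zero s
    · simp only [hγ.periodic s]
    · exact hγ.injOn hs hs' (h.injOn t ht (hO s) (hO s') heq)
    · rw [curve, ← hγ.range_eq, ← range_comp]; rfl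

namespace IsCurveFamily

variable {g : ℝ × ℝ → Plane} {L : ℝ} {J : Set ℝ} {Γ : ℝ → Set Plane}

/-- The derivative of the family with respect to the curve parameter. -/
def velocity (g : ℝ × ℝ → Plane) (J : Set ℝ) (z : ℝ × ℝ) : Plane :=
  fderivWithin ℝ g (univ ×ˢ J) z (1, 0)

theorem velocity_contDiffOn (h : IsCurveFamily g L J Γ) :
    ContDiffOn ℝ 2 (velocity g J) (univ ×ˢ J) :=
  (h.contDiffOn.fderivWithin (uniqueDiffOn_univ.prod h.uniqueDiffOn)
    (by norm_num)).clm_apply contDiffOn_const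

/-- At an endpoint of `J` the joint derivative is only one within the set, but the `s`-direction
stays in the set, so the partial derivative is an ordinary one. -/
theorem deriv_eq_velocity (h : IsCurveFamily g L J Γ) {t : ℝ} (ht : t ∈ J) (s : ℝ) :
    deriv (fun s => g (s, t)) s = velocity g J (s, t) := by
  have h1 : HasFDerivWithinAt g (fderivWithin ℝ g (univ ×ˢ J) (s, t)) (univ ×ˢ J) (s, t) :=
    (h.contDiffOn.differentiableOn (by norm_num) _ ⟨mem_univ _, ht⟩).hasFDerivWithinAt
  have h2 : HasDerivWithinAt (fun s : ℝ => (s, t)) (1, 0) univ s :=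
    ((hasDerivAt_id s).prodMk (hasDerivAt_const s t)).hasDerivWithinAt
  have hm : MapsTo (fun s : ℝ => (s, t)) univ (univ ×ˢ J) := fun s _ => ⟨mem_univ _, ht⟩
  have h3 := h1.comp_hasDerivWithinAt s h2 hm
  exact (hasDerivWithinAt_univ.1 h3).deriv

theorem continuousOn_unsignedDist (h : IsCurveFamily g L J Γ) :
    ContinuousOn (fun x : Plane × ℝ => unsignedDist (Γ x.2) x.1) (univ ×ˢ J) := by
  rw [continuousOn_iff_continuous_domRestrict]
  have hg : Continuous fun z : (univ ×ˢ J : Set (Plane × ℝ)) × ℝ => g (z.2, z.1.1.2) :=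
    h.contDiffOn.continuousOn.comp_continuous (by fun_prop) fun z => ⟨mem_univ _, z.1.2.2⟩
  have hf : Continuous ↿fun (x : (univ ×ˢ J : Set (Plane × ℝ))) (s : ℝ) =>
      dist x.1.1 (g (s, x.1.2)) :=
    Continuous.dist (by fun_prop) hg
  refine ((isCompact_Icc (a := (0 : ℝ)) (b := 0 + L)).continuous_sInf hf).congr fun x => ?_
  have hj := h.isJordanParam x.1.2 x.2.2
  have himg : Γ x.1.2 = (fun s => g (s, x.1.2)) '' Icc 0 (0 + L) := by
    rw [hj.periodic.image_Icc hj.period_pos 0, hj.range_eq]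
  simp only [domRestrict_apply, unsignedDist]
  rw [Metric.infDist_eq_iInf, ← sInf_image', himg, image_image]

/-- Off the moving curves the winding integral is jointly continuous, and values in `2πiℤ` less than
`2π` apart coincide. -/
theorem eventually_wind_eq (h : IsCurveFamily g L J Γ) {r₀ : Plane} {t₀ : ℝ} (ht₀ : t₀ ∈ J)
    (hr₀ : r₀ ∉ Γ t₀) : ∀ᶠ x : Plane × ℝ in 𝓝[univ ×ˢ J] (r₀, t₀), x.1 ∉ Γ x.2 ∧
      wind (fun s => g (s, x.2)) L x.1 = wind (fun s => g (s, t₀)) L r₀ := by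
  set S : Set (Plane × ℝ) := {x | x.2 ∈ J ∧ x.1 ∉ Γ x.2}
  have hj₀ := h.isJordanParam t₀ ht₀
  have hpos : 0 < unsignedDist (Γ t₀) r₀ :=
    (hj₀.isCompact.isClosed.notMem_iff_infDist_pos hj₀.nonempty).1 hr₀
  have hS : ∀ᶠ x : Plane × ℝ in 𝓝[univ ×ˢ J] (r₀, t₀), x ∈ S := by
    filter_upwards [(h.continuousOn_unsignedDist (r₀, t₀) ⟨mem_univ _, ht₀⟩).eventually_const_lt
      hpos, self_mem_nhdsWithin] with x hx hxJ
    refine ⟨hxJ.2, fun hm => ?_⟩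
    rw [unsignedDist, Metric.infDist_zero_of_mem hm] at hx
    exact lt_irrefl _ hx
  have hwc : ContinuousOn (fun x : Plane × ℝ => wind (fun s => g (s, x.2)) L x.1) S := by
    have hmap : MapsTo (fun z : (Plane × ℝ) × ℝ => (z.2, z.1.2)) (S ×ˢ Icc 0 L) (univ ×ˢ J) :=
      fun z hz => ⟨mem_univ _, hz.1.1⟩
    have hmc : ContinuousOn (fun z : (Plane × ℝ) × ℝ => (z.2, z.1.2)) (S ×ˢ Icc 0 L) := by
      fun_prop
    refine (continuousOn_intervalIntegral (f := fun (x : Plane × ℝ) s =>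
      toC (velocity g J (s, x.2)) / (toC (g (s, x.2)) - toC x.1)) hj₀.period_pos.le ?_).congr ?_
    · refine ContinuousOn.div ?_ (ContinuousOn.sub ?_ ?_) ?_
      · exact toC.continuous.comp_continuousOn
          (h.velocity_contDiffOn.continuousOn.comp hmc hmap)
      · exact toC.continuous.comp_continuousOn (h.contDiffOn.continuousOn.comp hmc hmap)
      · exact (toC.continuous.comp (continuous_fst.comp continuous_fst)).continuousOn
      · rintro ⟨x, s⟩ ⟨hx, -⟩ h0
        have := toC.injective (sub_eq_zero.1 h0)
        exact hx.2 (this ▸ (h.isJordanParam x.2 hx.1).mem s)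
    · intro x hx
      have hj := h.isJordanParam x.2 hx.1
      simp only [wind, windInt]
      refine intervalIntegral.integral_congr fun s _ => ?_
      simp only [hj.deriv_toC, h.deriv_eq_velocity hx.1, Function.comp_apply]
  have hx₀ : (r₀, t₀) ∈ S := ⟨ht₀, hr₀⟩
  have hnear := (hwc _ hx₀) (Metric.ball_mem_nhds _ Real.two_pi_pos)
  have hle : 𝓝[univ ×ˢ J] (r₀, t₀) ≤ 𝓝[S] (r₀, t₀) :=
    nhdsWithin_le_iff.2 hS
  filter_upwards [hS, hle hnear] with x hx hxn
  refine ⟨hx.2, eq_of_two_pi_I_int ((h.isJordanParam x.2 hx.1).wind_eq_int hx.2)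
    (hj₀.wind_eq_int hr₀) ?_⟩
  rw [← dist_eq_norm]
  exact hxn

theorem continuousOn_signedDist (h : IsCurveFamily g L J Γ) :
    ContinuousOn (fun x : Plane × ℝ => signedDist (Γ x.2) x.1) (univ ×ˢ J) := by
  rintro ⟨r₀, t₀⟩ hx₀
  have hδ := h.continuousOn_unsignedDist (r₀, t₀) hx₀
  have hj₀ := h.isJordanParam t₀ hx₀.2
  by_cases hr₀ : r₀ ∈ Γ t₀
  · have h0 : unsignedDist (Γ t₀) r₀ = 0 := Metric.infDist_zero_of_mem hr₀
    have habs : ∀ (C : Set Plane) r, |signedDist C r| ≤ unsignedDist C r := fun C r => by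
      have : 0 ≤ unsignedDist C r := Metric.infDist_nonneg
      unfold signedDist
      split_ifs <;> simp [abs_of_nonneg this]
    have hd0 : signedDist (Γ t₀) r₀ = 0 := abs_nonpos_iff.1 (h0 ▸ habs _ _)
    rw [ContinuousWithinAt, hd0]
    rw [ContinuousWithinAt, h0] at hδ
    exact squeeze_zero_norm (fun x => habs _ _) hδ
  · have hin : ∀ᶠ x : Plane × ℝ in 𝓝[univ ×ˢ J] (r₀, t₀),
        (x.1 ∈ inside (Γ x.2) ↔ r₀ ∈ inside (Γ t₀)) := by
      filter_upwards [h.eventually_wind_eq hx₀.2 hr₀, self_mem_nhdsWithin] with x hx hxJ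
      have hj := h.isJordanParam x.2 hxJ.2
      obtain ⟨ε, ho⟩ := hj.exists_isOrientation
      obtain ⟨ε₀, ho₀⟩ := hj₀.exists_isOrientation
      rw [ho.mem_inside_iff hj hx.1, ho₀.mem_inside_iff hj₀ hr₀, hx.2]
    by_cases hi : r₀ ∈ inside (Γ t₀)
    · refine hδ.neg.congr_of_eventuallyEq ?_ (if_pos hi)
      filter_upwards [hin] with x hx
      exact if_pos (hx.2 hi)
    · refine hδ.congr_of_eventuallyEq ?_ (if_neg hi)
      filter_upwards [hin] with x hx
      exact if_neg fun hx' => hi (hx.1 hx')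

/-- The orientation is locally constant in time. -/
theorem eventually_orientation_eq (h : IsCurveFamily g L J Γ) {t₀ : ℝ} (ht₀ : t₀ ∈ J) {ε₀ : ℝ}
    (ho₀ : IsOrientation (fun s => g (s, t₀)) L (Γ t₀) ε₀) :
    ∀ᶠ t in 𝓝[J] t₀, IsOrientation (fun s => g (s, t)) L (Γ t) ε₀ := by
  -- A fixed point `r` inside stays inside for nearby times with the same winding integral, which
  -- determines the sign.
  obtain ⟨r, hr⟩ := ho₀.inside_nonempty
  have hlim : Tendsto (fun t => (r, t)) (𝓝[J] t₀) (𝓝[univ ×ˢ J] (r, t₀)) :=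
    tendsto_nhdsWithin_iff.2 ⟨((Continuous.prodMk_right r).tendsto t₀).mono_left
      nhdsWithin_le_nhds, eventually_nhdsWithin_of_forall fun t ht => ⟨mem_univ _, ht⟩⟩
  filter_upwards [hlim.eventually (h.eventually_wind_eq ht₀ hr.1), self_mem_nhdsWithin]
    with t ht htJ
  have hj := h.isJordanParam t htJ
  have hj₀ := h.isJordanParam t₀ ht₀
  obtain ⟨ε, ho⟩ := hj.exists_isOrientation
  have hi : r ∈ inside (Γ t) := by
    rw [ho.mem_inside_iff hj ht.1, ht.2, ← ho₀.mem_inside_iff hj₀ hr.1]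
    exact hr
  have heq := ht.2
  simp only [ho.wind_inside r hi, ho₀.wind_inside r hr] at heq
  have : ε = ε₀ := by
    have := mul_right_cancel₀ Complex.two_pi_I_ne_zero heq
    exact_mod_cast this
  exact this ▸ ho

end IsCurveFamily

/-! ### Smoothness of continuous solutions of `F (s x, x) = 0` -/

section Implicit

variable {E : Type*} [NormedAddCommGroup E] [NormedSpace ℝ E]

/-- A continuous solution `s` of `F (s x, x) = 0` on an arbitrary set is differentiable within this
set if `∂F/∂s ≠ 0`. -/
theorem hasFDerivWithinAt_of_implicit {F : ℝ × E → ℝ} {F' : ℝ × E →L[ℝ] ℝ} {D : Set (ℝ × E)}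
    {s : E → ℝ} {N : Set E} {x : E} (hF : HasFDerivWithinAt F F' D (s x, x)) (hx : x ∈ N)
    (hs : ContinuousWithinAt s N x) (hD : ∀ y ∈ N, (s y, y) ∈ D) (h0 : ∀ y ∈ N, F (s y, y) = 0)
    (hne : F' (1, 0) ≠ 0) :
    HasFDerivWithinAt s (-((F' (1, 0))⁻¹ • (F' ∘L ContinuousLinearMap.inr ℝ ℝ E))) N x := by
  have hf : HasFDerivWithinAt (fun z : ℝ × E => (F z, z.2))
      (F'.prod (ContinuousLinearMap.snd ℝ ℝ E)) D (s x, x) :=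
    hF.prodMk hasFDerivWithinAt_snd
  have hg : Tendsto (fun y => (s y, y)) (𝓝[N] x) (𝓝[D] (s x, x)) :=
    tendsto_nhdsWithin_iff.2 ⟨hs.prodMk continuousWithinAt_id,
      eventually_nhdsWithin_of_forall hD⟩
  have hh : HasFDerivWithinAt (fun y : E => ((0 : ℝ), y)) (ContinuousLinearMap.inr ℝ ℝ E) N x :=
    (ContinuousLinearMap.inr ℝ ℝ E).hasFDerivWithinAt
  -- `G` inverts the derivative of `z ↦ (F z, z.2)`. Along the solution this map is `y ↦ (0, y)`, so
  -- differentiability passes to `y ↦ (s y, y)`.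
  set G : ℝ × E →L[ℝ] ℝ × E := ((F' (1, 0))⁻¹ • (ContinuousLinearMap.fst ℝ ℝ E -
    (F' ∘L ContinuousLinearMap.inr ℝ ℝ E) ∘L ContinuousLinearMap.snd ℝ ℝ E)).prod
      (ContinuousLinearMap.snd ℝ ℝ E) with hG
  have hleft : Function.LeftInverse G (F'.prod (ContinuousLinearMap.snd ℝ ℝ E)) := by
    rintro ⟨a, y⟩
    have hsplit : F' (a, y) = a * F' (1, 0) + F' (0, y) := by
      rw [← smul_eq_mul, ← map_smul, ← map_add]; simp
    ext
    · simp [hG, hsplit]; field_simp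
    · simp [hG]
  have key := HasFDerivWithinAt.of_comp_of_leftInverse hg hf hh
    (eventually_nhdsWithin_of_forall fun y hy => by simp [h0 y hy]) hleft hx
  refine (hasFDerivAt_fst.comp_hasFDerivWithinAt x key).congr_fderiv ?_
  ext y
  simp [hG]

/-- A continuous solution `s` of `F (s x, x) = 0` on an arbitrary set is `C²` on this set if `F` is
and `∂F/∂s ≠ 0`. -/
theorem contDiffOn_of_implicit {F : ℝ × E → ℝ} {D : Set (ℝ × E)} (hD : UniqueDiffOn ℝ D)
    (hF : ContDiffOn ℝ 2 F D) {s : E → ℝ} {N : Set E} (hs : ContinuousOn s N)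
    (hsD : ∀ y ∈ N, (s y, y) ∈ D) (h0 : ∀ y ∈ N, F (s y, y) = 0)
    (hne : ∀ y ∈ N, fderivWithin ℝ F D (s y, y) (1, 0) ≠ 0) : ContDiffOn ℝ 2 s N := by
  set s' : E → E →L[ℝ] ℝ := fun y => -((fderivWithin ℝ F D (s y, y) (1, 0))⁻¹ •
    (fderivWithin ℝ F D (s y, y) ∘L ContinuousLinearMap.inr ℝ ℝ E))
  have hd : ∀ y ∈ N, HasFDerivWithinAt s (s' y) N y := fun y hy =>
    hasFDerivWithinAt_of_implicit
      ((hF.differentiableOn (by norm_num) _ (hsD y hy)).hasFDerivWithinAt) hy (hs y hy) hsD h0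
      (hne y hy)
  have hF' : ContDiffOn ℝ 1 (fderivWithin ℝ F D) D := hF.fderivWithin hD (by norm_num)
  -- Bootstrap: `s'` is built from `s` and the `C¹` derivative of `F`, so each step gains one order,
  -- up to `C²`.
  have hstep : ∀ n : WithTop ℕ∞, n ≤ 1 → ContDiffOn ℝ n s N → ContDiffOn ℝ (n + 1) s N :=
    fun n hn hsn => by
    have hninf : n ≠ ⊤ := fun h => by simp [h] at hn
    have hc : ContDiffOn ℝ n (fun y => fderivWithin ℝ F D (s y, y)) N :=
      (hF'.of_le hn).comp (f := fun y => (s y, y)) (hsn.prodMk contDiffOn_id) hsD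
    have hs'n : ContDiffOn ℝ n s' N := by
      have h1 : ContDiffOn ℝ n (fun y => (fderivWithin ℝ F D (s y, y) (1, 0))⁻¹) N :=
        (hc.clm_apply contDiffOn_const).inv hne
      exact (h1.smul (hc.clm_comp contDiffOn_const)).neg
    rw [contDiffOn_succ_iff_hasFDerivWithinAt (fun h => by simp [h] at hn)]
    intro x hx
    refine ⟨N, by rw [insert_eq_of_mem hx]; exact self_mem_nhdsWithin,
      fun h => absurd h hninf, s', hd, hs'n⟩
  have h1 := hstep 0 (by norm_num) (contDiffOn_zero.2 hs)
  rw [zero_add] at h1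
  have h2 := hstep 1 le_rfl h1
  rwa [one_add_one_eq_two] at h2

end Implicit

/-! ### The projection onto a moving curve -/

/-- `proj` picks the nearest point whenever there is exactly one. -/
theorem isNearest_iff_eq_proj {Γ : Set Plane} {r : Plane} (h : ∃! p, IsNearest Γ r p) (p : Plane) :
    IsNearest Γ r p ↔ p = proj Γ r := by
  have hspec : IsNearest Γ r (proj Γ r) := Classical.epsilon_spec h.exists
  exact ⟨fun hp => h.unique hp hspec, fun hp => hp ▸ hspec⟩

namespace IsCurveFamily

variable {g : ℝ × ℝ → Plane} {L : ℝ} {J : Set ℝ} {Γ : ℝ → Set Plane}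

/-- Near a point of `M`, the projection has a continuous curve parameter. -/
theorem exists_param_continuousOn (h : IsCurveFamily g L J Γ) {M : Set (Plane × ℝ)}
    (hMJ : M ⊆ univ ×ˢ J) (hM : ∀ x ∈ M, ∃! p, IsNearest (Γ x.2) x.1 p) {x₀ : Plane × ℝ}
    (hx₀ : x₀ ∈ M) : ∃ s : Plane × ℝ → ℝ, ∃ N ⊆ M, N ∈ 𝓝[M] x₀ ∧ ContinuousOn s N ∧
      ∀ x ∈ N, g (s x, x.2) = proj (Γ x.2) x.1 := by
  have hproj : ∀ x ∈ M, IsNearest (Γ x.2) x.1 (proj (Γ x.2) x.1) := fun x hx =>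
    (isNearest_iff_eq_proj (hM x hx) _).2 rfl
  have hj : ∀ x ∈ M, IsJordanParam (fun s => g (s, x.2)) L (Γ x.2) := fun x hx =>
    h.isJordanParam x.2 (hMJ hx).2
  have hL : 0 < L := (hj x₀ hx₀).period_pos
  obtain ⟨s₀, -, hs₀⟩ := (hj x₀ hx₀).exists_param (hproj x₀ hx₀).1 0
  set K := Icc (s₀ - L / 2) (s₀ + L / 2) with hK
  choose! s hsK hs using fun x hx => (hj x hx).exists_param (hproj x hx).1 s₀
  have hsx₀ : s x₀ = s₀ :=
    (hj x₀ hx₀).eq_of_mem_Icc (hsK x₀ hx₀) ((hs x₀ hx₀).trans hs₀.symm)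
  -- Only the endpoints of `K` give the same curve point twice; for `s x` in the open interval the
  -- minimizing parameter in `K` is unique.
  have hcont : ∀ x ∈ M, s x ∈ Ioo (s₀ - L / 2) (s₀ + L / 2) → ContinuousWithinAt s M x :=
    fun x hx hsx => by
    refine continuousWithinAt_argmin (f := fun x s => dist x.1 (g (s, x.2))) isCompact_Icc
      (K := K) ?_ hsK ?_ hx ?_
    · refine continuous_dist.comp_continuousOn (ContinuousOn.prodMk (by fun_prop)
        (h.contDiffOn.continuousOn.comp
          (f := fun z : (Plane × ℝ) × ℝ => (z.2, z.1.2)) (by fun_prop) ?_))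
      exact fun z hz => ⟨mem_univ _, (hMJ hz.1).2⟩
    · intro y hy σ _
      rw [hs y hy]
      exact (hproj y hy).2 _ ((hj y hy).mem σ)
    · intro σ hσ hle
      refine (hj x hx).eq_of_abs_lt ?_ ?_
      · rw [abs_lt]
        constructor <;> linarith [hσ.1, hσ.2, hsx.1, hsx.2]
      · rw [hs x hx] at hle ⊢
        exact (isNearest_iff_eq_proj (hM x hx) _).1
          ⟨(hj x hx).mem σ, fun q hq => hle.trans ((hproj x hx).2 q hq)⟩
  have hs₀I : Ioo (s₀ - L / 2) (s₀ + L / 2) ∈ 𝓝 (s x₀) := by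
    rw [hsx₀]; exact Ioo_mem_nhds (by linarith) (by linarith)
  refine ⟨s, {x ∈ M | s x ∈ Ioo (s₀ - L / 2) (s₀ + L / 2)}, fun x hx => hx.1, ?_,
    fun x hx => (hcont x hx.1 hx.2).mono fun y hy => hy.1, fun x hx => hs x hx.1⟩
  exact Filter.inter_mem self_mem_nhdsWithin
    (hcont x₀ hx₀ (mem_of_mem_nhds hs₀I) hs₀I)

theorem continuousOn_proj (h : IsCurveFamily g L J Γ) {M : Set (Plane × ℝ)}
    (hMJ : M ⊆ univ ×ˢ J) (hM : ∀ x ∈ M, ∃! p, IsNearest (Γ x.2) x.1 p) :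
    ContinuousOn (fun x : Plane × ℝ => proj (Γ x.2) x.1) M := by
  intro x₀ hx₀
  obtain ⟨s, N, hNM, hN, hsc, hs⟩ := h.exists_param_continuousOn hMJ hM hx₀
  have hc : ContinuousOn (fun x : Plane × ℝ => g (s x, x.2)) N :=
    h.contDiffOn.continuousOn.comp (hsc.prodMk continuousOn_snd)
      fun x hx => ⟨mem_univ _, (hMJ (hNM hx)).2⟩
  have hx₀N := mem_of_mem_nhdsWithin hx₀ hN
  refine ((hc x₀ hx₀N).mono_of_mem_nhdsWithin hN).congr_of_eventuallyEq ?_ (hs x₀ hx₀N).symm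
  filter_upwards [hN] with x hx using (hs x hx).symm

/-- The curve parameter of the projection is `C²` away from focal points. -/
theorem contDiffOn_param (h : IsCurveFamily g L J Γ) {N : Set (Plane × ℝ)}
    (hNJ : N ⊆ univ ×ˢ J) {s : Plane × ℝ → ℝ} (hsc : ContinuousOn s N)
    (hs : ∀ x ∈ N, IsNearest (Γ x.2) x.1 (g (s x, x.2)))
    (hfoc : ∀ x ∈ N, 1 + signedCurvature (Γ x.2) (g (s x, x.2)) * signedDist (Γ x.2) x.1 ≠ 0) :
    ContDiffOn ℝ 2 s N := by
  set D : Set (ℝ × (Plane × ℝ)) := univ ×ˢ (univ ×ˢ J)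
  have hpr : MapsTo (fun z : ℝ × (Plane × ℝ) => (z.1, z.2.2)) D (univ ×ˢ J) :=
    fun z hz => ⟨mem_univ _, hz.2.2⟩
  have hprc : ContDiffOn ℝ 2 (fun z : ℝ × (Plane × ℝ) => (z.1, z.2.2)) D := by fun_prop
  -- Half the `s`-derivative of the squared distance; its own `s`-derivative is the second
  -- variation, nonzero away from focal points.
  set F : ℝ × (Plane × ℝ) → ℝ := fun z =>
    inner ℝ (g (z.1, z.2.2) - z.2.1) (velocity g J (z.1, z.2.2)) with hF_def
  have hF : ContDiffOn ℝ 2 F D :=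
    (((h.contDiffOn.of_le (by norm_num)).comp hprc hpr).sub (by fun_prop)).inner ℝ
      (h.velocity_contDiffOn.comp hprc hpr)
  refine contDiffOn_of_implicit (uniqueDiffOn_univ.prod (uniqueDiffOn_univ.prod h.uniqueDiffOn)) hF
    hsc (fun x hx => ⟨mem_univ _, hNJ hx⟩) (fun x hx => ?_) (fun x hx => ?_)
  · have := (h.isJordanParam x.2 (hNJ hx).2).inner_eq_zero_of_isNearest (hs x hx)
    rw [h.deriv_eq_velocity (hNJ hx).2] at this
    rw [hF_def]
    simp only
    rw [← neg_sub, inner_neg_left, this, neg_zero]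
  · have hj := h.isJordanParam x.2 (hNJ hx).2
    have hm : MapsTo (fun σ : ℝ => (σ, x)) univ D := fun σ _ => ⟨mem_univ _, hNJ hx⟩
    have h1 : HasDerivAt (fun σ => F (σ, x)) (fderivWithin ℝ F D (s x, x) (1, 0)) (s x) := by
      have hd : HasFDerivWithinAt F (fderivWithin ℝ F D (s x, x)) D (s x, x) :=
        (hF.differentiableOn (by norm_num) _ ⟨mem_univ _, hNJ hx⟩).hasFDerivWithinAt
      have h2 : HasDerivWithinAt (fun σ : ℝ => (σ, x)) (1, 0) univ (s x) :=
        ((hasDerivAt_id _).prodMk (hasDerivAt_const _ x)).hasDerivWithinAt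
      have h3 := hd.comp_hasDerivWithinAt (s x) h2 hm
      exact hasDerivWithinAt_univ.1 h3
    have h2 := ((hj.hasDerivAt (s x)).sub_const x.1).inner ℝ (hj.hasDerivAt_deriv (s x))
    have h3 : (fun σ => F (σ, x)) = fun σ => (inner ℝ (g (σ, x.2) - x.1)
        (deriv (fun s => g (s, x.2)) σ) : ℝ) := by
      funext σ
      rw [h.deriv_eq_velocity (hNJ hx).2]
    rw [h3] at h1
    rw [h1.unique h2, add_comm, real_inner_self_eq_norm_sq, hj.second_variation_eq (hs x hx)]
    exact mul_ne_zero (pow_ne_zero _ (norm_ne_zero_iff.2 (hj.deriv_ne_zero _))) (hfoc x hx)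

theorem contDiffOn_proj_signedDist (h : IsCurveFamily g L J Γ) {M : Set (Plane × ℝ)}
    (hMJ : M ⊆ univ ×ˢ J) (hM : ∀ x ∈ M, ∃! p, IsNearest (Γ x.2) x.1 p)
    (hfoc : ∀ x ∈ M,
      1 + signedCurvature (Γ x.2) (proj (Γ x.2) x.1) * signedDist (Γ x.2) x.1 ≠ 0) :
    ContDiffOn ℝ 2 (fun x : Plane × ℝ => signedDist (Γ x.2) x.1) M ∧
      ContDiffOn ℝ 2 (fun x : Plane × ℝ => proj (Γ x.2) x.1) M := by
  have main : ∀ x₀ ∈ M,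
      ContDiffWithinAt ℝ 2 (fun x : Plane × ℝ => signedDist (Γ x.2) x.1) M x₀ ∧
      ContDiffWithinAt ℝ 2 (fun x : Plane × ℝ => proj (Γ x.2) x.1) M x₀ := fun x₀ hx₀ => by
    obtain ⟨s, N, hNM, hN, hsc, hs⟩ := h.exists_param_continuousOn hMJ hM hx₀
    have hNJ : N ⊆ univ ×ˢ J := hNM.trans hMJ
    have hx₀N := mem_of_mem_nhdsWithin hx₀ hN
    have hnear : ∀ x ∈ N, IsNearest (Γ x.2) x.1 (g (s x, x.2)) := fun x hx =>
      (isNearest_iff_eq_proj (hM x (hNM hx)) _).2 (hs x hx)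
    have hs2 : ContDiffOn ℝ 2 s N := h.contDiffOn_param hNJ hsc hnear fun x hx => by
      rw [hs x hx]; exact hfoc x (hNM hx)
    have hpair : ContDiffOn ℝ 2 (fun x : Plane × ℝ => (s x, x.2)) N :=
      hs2.prodMk contDiffOn_snd
    have hmaps : MapsTo (fun x : Plane × ℝ => (s x, x.2)) N (univ ×ˢ J) :=
      fun x hx => ⟨mem_univ _, (hNJ hx).2⟩
    have hg : ContDiffOn ℝ 2 (fun x : Plane × ℝ => g (s x, x.2)) N :=
      (h.contDiffOn.of_le (by norm_num)).comp hpair hmaps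
    have hv : ContDiffOn ℝ 2 (fun x : Plane × ℝ => velocity g J (s x, x.2)) N :=
      h.velocity_contDiffOn.comp hpair hmaps
    have hv0 : ∀ x ∈ N, velocity g J (s x, x.2) ≠ 0 := fun x hx => by
      rw [← h.deriv_eq_velocity (hNJ hx).2]
      exact (h.isJordanParam x.2 (hNJ hx).2).deriv_ne_zero _
    -- The sign is fixed at time `x₀.2`; it remains valid nearby, so one explicit formula represents
    -- `d` around `x₀`.
    obtain ⟨ε, ho⟩ := (h.isJordanParam x₀.2 (hMJ hx₀).2).exists_isOrientation
    have hd : ContDiffOn ℝ 2 (fun x : Plane × ℝ => -ε * inner ℝ (x.1 - g (s x, x.2))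
        (rotL (velocity g J (s x, x.2))) / ‖velocity g J (s x, x.2)‖) N := by
      refine (contDiffOn_const.mul ((contDiffOn_fst.sub hg).inner ℝ
        (rotL.contDiff.comp_contDiffOn hv))).div (hv.norm ℝ hv0)
        fun x hx => norm_ne_zero_iff.2 (hv0 x hx)
    have heq : ∀ x ∈ N, IsOrientation (fun s => g (s, x.2)) L (Γ x.2) ε →
        signedDist (Γ x.2) x.1 = -ε * inner ℝ (x.1 - g (s x, x.2))
        (rotL (velocity g J (s x, x.2))) / ‖velocity g J (s x, x.2)‖ := fun x hx ho => by
      rw [ho.signedDist_eq (h.isJordanParam x.2 (hNJ hx).2) (hnear x hx),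
        h.deriv_eq_velocity (hNJ hx).2, rotL_apply]
    have htime : Tendsto (fun x : Plane × ℝ => x.2) (𝓝[M] x₀) (𝓝[J] x₀.2) :=
      tendsto_nhdsWithin_iff.2 ⟨(continuous_snd.tendsto x₀).mono_left nhdsWithin_le_nhds,
        eventually_nhdsWithin_of_forall fun x hx => (hMJ hx).2⟩
    constructor
    · refine ((hd x₀ hx₀N).mono_of_mem_nhdsWithin hN).congr_of_eventuallyEq ?_ (heq x₀ hx₀N ho)
      filter_upwards [hN, htime.eventually (h.eventually_orientation_eq (hMJ hx₀).2 ho)]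
        with x hx hox using heq x hx hox
    · refine ((hg x₀ hx₀N).mono_of_mem_nhdsWithin hN).congr_of_eventuallyEq ?_ (hs x₀ hx₀N).symm
      filter_upwards [hN] with x hx using (hs x hx).symm
  exact ⟨fun x hx => (main x hx).1, fun x hx => (main x hx).2⟩

end IsCurveFamily

end MovingCurve

end

theorem mainTheorem1 (Γref O : Set MovingCurve.Plane) (J : Set ℝ)
    (Φ : MovingCurve.Plane × ℝ → MovingCurve.Plane)
    (hJ : J = Set.univ ∨ J = Set.Ici 0)
    (hΦ : MovingCurve.IsConfiguration Γref O J Φ)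
    (hb : MovingCurve.IsBoundedConfiguration O J Φ) :
    -- i) continuity of the unsigned and of the signed distance
    (ContinuousOn (fun x : MovingCurve.Plane × ℝ =>
        MovingCurve.unsignedDist (MovingCurve.curve Γref Φ x.2) x.1) (Set.univ ×ˢ J) ∧
      ContinuousOn (fun x : MovingCurve.Plane × ℝ =>
        MovingCurve.signedDist (MovingCurve.curve Γref Φ x.2) x.1) (Set.univ ×ˢ J)) ∧
    (∀ M : Set (MovingCurve.Plane × ℝ), M ⊆ Set.univ ×ˢ J →
      (∀ x ∈ M, ∃! p, MovingCurve.IsNearest (MovingCurve.curve Γref Φ x.2) x.1 p) →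
      -- ii) the projection is well defined and continuous
      ((∀ x ∈ M, ∀ p, MovingCurve.IsNearest (MovingCurve.curve Γref Φ x.2) x.1 p ↔
          p = MovingCurve.proj (MovingCurve.curve Γref Φ x.2) x.1) ∧
        ContinuousOn (fun x : MovingCurve.Plane × ℝ =>
          MovingCurve.proj (MovingCurve.curve Γref Φ x.2) x.1) M) ∧
      -- iii) smoothness away from the focal points, for `M` open in `ℝ² × J`
      ((∃ U : Set (MovingCurve.Plane × ℝ), IsOpen U ∧ M = U ∩ (Set.univ ×ˢ J)) →
        (∀ x ∈ M, 1 + MovingCurve.signedCurvature (MovingCurve.curve Γref Φ x.2)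
            (MovingCurve.proj (MovingCurve.curve Γref Φ x.2) x.1) *
          MovingCurve.signedDist (MovingCurve.curve Γref Φ x.2) x.1 ≠ 0) →
        ContDiffOn ℝ 2 (fun x : MovingCurve.Plane × ℝ =>
          MovingCurve.signedDist (MovingCurve.curve Γref Φ x.2) x.1) M ∧
        ContDiffOn ℝ 2 (fun x : MovingCurve.Plane × ℝ =>
          MovingCurve.proj (MovingCurve.curve Γref Φ x.2) x.1) M)) := by
  obtain ⟨g, L, h⟩ := hΦ.exists_isCurveFamily hJ
  refine ⟨⟨h.continuousOn_unsignedDist, h.continuousOn_signedDist⟩, fun M hMJ hM => ⟨⟨fun x hx p =>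
    MovingCurve.isNearest_iff_eq_proj (hM x hx) p, h.continuousOn_proj hMJ hM⟩, fun _ hfoc =>
    h.contDiffOn_proj_signedDist hMJ hM hfoc⟩⟩
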